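/- **Setting.** For $n,m\ge 1$ let $A_{n,m}$ be the annulus with $n$ marked points $v_1,\dots,v_n$ on the outer and $m$ marked points on the inner boundary, and let $S_n$ be the disc with $n$ marked points $v_1,\dots,v_n$ on its (outer) boundary and one puncture, which is also a marked point; the $v_k$ are labelled counterclockwise. A *dissection* $\mathcal D$ of $A_{n,m}$ or $S_n$ is a set of pairwise non-crossing simple arcs (up to homotopy, pairwise non-homotopic and not homotopic to boundary segments), each joining two outer vertices, or an outer vertex to an inner vertex (respectively to the puncture), which cuts the surface into polygons, called *subgons*. (Arcs joining two vertices of the inner boundary are excluded.) The size $|\mathcal P|$ of a subgon is its number of edges, an edge bounding $\mathcal P$ on both sides being counted twice. Let $I$ be the dissected infinite strip covering the surface (for $S_n$, the bridging arcs lift to asymptotic arcs meeting at $+\infty$, which counts as a vertex), with lower boundary vertices $v_k$, $k\in\mathbb Z$, lying over $v_{k \bmod n}$, numbered from left to right (counterclockwise around the outer boundary). Put $\lambda_p=2\cos(\pi/p)$, and let $U_k$ be given by $U_{-1}(x)=0$, $U_0(x)=1$, $U_{k+1}(x)=x\,U_k(x)-U_{k-1}(x)$. An *infinite frieze pattern*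 is an array $(m_{i,j})_{i\le j}$, $i,j\in\mathbb Z$, of real numbers with $m_{i,i}=0$, $m_{i,i+1}=1$ and $m_{i-1,j}\,m_{i,j+1}-m_{i,j}\,m_{i-1,j+1}=1$ for all $i\le j$. It *comes from* $\mathcal D$ if $m_{i-1,i+1}=\sum_{\mathcal P}\lambda_{|\mathcal P|}$ for all $i\in\mathbb Z$, where $\mathcal P$ runs over the subgons of $I$ incident to $v_i$ (equivalently, over the subgons of $\mathcal D$ met by a small half circle around $v_{i \bmod n}$, with multiplicity). Such a pattern is $n$-periodic, and of Type $\Lambda_{p_1,\dots,p_s}$, where $p_1,\dots,p_s$ are the sizes of the subgons of $\mathcal D$ incident to the outer boundary. Its *principal growth coefficient* is $s_1=m_{0,n+1}-m_{1,n}$. For $i\in\mathbb Z$ let $\mathcal M_{i,i+n+1}$ be the set of sequences $w=(\mathcal P_{i+1},\dots,\mathcal P_{i+n})$ of subgons of $I$ such that $\mathcal P_k$ is incident to $v_k$ for $i+1\le k\le i+n$. For a subgon $\mathcal P$ of $\mathcal D$ let $N_{\mathcal P}(w)$ be the number of indices $k$ such that $\mathcal P_k$ is a lift of $\mathcal P$.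 The *annulus weight* of $w$ is $$wt_A(w)=\begin{cases}0 & \text{if } N_{\mathcal P}(w)>|\mathcal P|-2\text{ for some subgon }\mathcal P\text{ of }\mathcal D,\\ \prod_{\mathcal P\in\mathcal D}U_{N_{\mathcal P}(w)}(\lambda_{|\mathcal P|}) & \text{otherwise.}\end{cases}$$ **Theorem.** Let $(m_{i,j})$ be an infinite frieze pattern that comes from a dissection $\mathcal D$ of $A_{n,m}$ or $S_n$, and let $s_1$ be its principal growth coefficient. Then for every $i\in\mathbb Z$, $$s_1=\sum_{w\in\mathcal M_{i,i+n+1}} wt_A(w).$$ -/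

import Mathlib

open scoped BigOperators

/-- The two kinds of marked surfaces: `annulus n m` has `n ≥ 1` marked points on the outer and
`m ≥ 1` marked points on the inner boundary; `puncturedDisc n` has `n ≥ 1` marked points on the
boundary, and its puncture is a marked point. -/
inductive Surface : Type
  | annulus (n m : ℕ) (hn : 1 ≤ n) (hm : 1 ≤ m)
  | puncturedDisc (n : ℕ) (hn : 1 ≤ n)

/-- The number `n` of vertices on the outer boundary. -/
def Surface.n : Surface → ℕ
  | .annulus n _ _ _ => n
  | .puncturedDisc n _ => n

lemma Surface.one_le_n (S : Surface) : 1 ≤ S.n := by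
  cases S <;> assumption

/-- Vertices of the infinite strip covering the surface: `outer k` is the `k`-th vertex of the
lower boundary, numbered from left to right (it lies over `v_k`, index modulo `n`);
`inner l` is the `l`-th vertex of the upper boundary, numbered from left to right (it occurs only
over an annulus); `puncture` is the point `+∞`, the common end of all asymptotic arcs (it occurs
only over a punctured disc). -/
inductive CoverVertex : Type
  | outer (k : ℤ)
  | inner (l : ℤ)
  | puncture

namespace CoverVertex

/-- Position along the boundary of the strip, seen as a disc and traversed counterclockwise: first
the lower boundary from left to right, then the upper boundary from right to left, or `+∞`. -/
def position : CoverVertex → ℤ ×ₗ ℤ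
  | outer k => toLex (0, k)
  | inner l => toLex (1, -l)
  | puncture => toLex (2, 0)

lemma position_injective : Function.Injective position := by
  intro x y h
  cases x <;> cases y <;> simp [position] at h ⊢ <;> exact h

/-- `x < y` means that `x` is met before `y` along the boundary, as described at `position`. -/
instance : LinearOrder CoverVertex := LinearOrder.lift' position position_injective

lemma lt_def {x y : CoverVertex} : x < y ↔ position x < position y := Iff.rfl

@[simp] lemma outer_lt_outer {a b : ℤ} : outer a < outer b ↔ a < b := by
  simp [lt_def, position, Prod.Lex.lt_iff]

@[simp] lemma inner_lt_inner {a b : ℤ} : inner a < inner b ↔ b < a := by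
  simp [lt_def, position, Prod.Lex.lt_iff]

@[simp] lemma outer_lt_inner {a b : ℤ} : outer a < inner b := by
  simp [lt_def, position, Prod.Lex.lt_iff]

@[simp] lemma outer_lt_puncture {a : ℤ} : outer a < puncture := by
  simp [lt_def, position, Prod.Lex.lt_iff]

@[simp] lemma inner_lt_puncture {a : ℤ} : inner a < puncture := by
  simp [lt_def, position, Prod.Lex.lt_iff]

end CoverVertex

/-- The `z`-th power of the generator of the deck group of the strip over the surface: it moves the
lower boundary by `z * n` and, for an annulus, the upper boundary by `z * m` steps. -/
def Surface.deck (S : Surface) (z : ℤ) : CoverVertex ≃ CoverVertex where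
  toFun
    | .outer k => .outer (k + z * S.n)
    | .inner l => match S with
        | .annulus _ m _ _ => .inner (l + z * m)
        | .puncturedDisc _ _ => .inner l
    | .puncture => .puncture
  invFun
    | .outer k => .outer (k - z * S.n)
    | .inner l => match S with
        | .annulus _ m _ _ => .inner (l - z * m)
        | .puncturedDisc _ _ => .inner l
    | .puncture => .puncture
  left_inv x := by cases S <;> cases x <;> simp
  right_inv x := by cases S <;> cases x <;> simp

lemma Surface.deck_zero (S : Surface) : S.deck 0 = Equiv.refl _ := by
  ext x; cases S <;> cases x <;> simp [Surface.deck]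

lemma Surface.deck_add (S : Surface) (y z : ℤ) :
    S.deck (y + z) = (S.deck y).trans (S.deck z) := by
  ext x; cases S <;> cases x <;> simp [Surface.deck] <;> ring

/-- `x` and `y`, with `x < y`, are neighbours on the boundary of the strip. -/
def Surface.IsBoundarySegment : Surface → CoverVertex → CoverVertex → Prop
  | _, .outer a, .outer b => b = a + 1
  | .annulus _ _ _ _, .inner a, .inner b => a = b + 1
  | _, _, _ => False

lemma Surface.IsBoundarySegment.not_between {S : Surface} {x y z : CoverVertex}
    (h : S.IsBoundarySegment x y) (hxz : x < z) (hzy : z < y) : False := by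
  cases S <;> cases x <;> cases y <;> cases z <;>
    simp [Surface.IsBoundarySegment, CoverVertex.lt_def, CoverVertex.position,
      Prod.Lex.lt_iff] at h hxz hzy <;> omega

/-- The arcs of the strip that may occur in a dissection, up to homotopy: a peripheral arc from
`outer a` to `outer b`, which is not homotopic to a boundary segment, a bridging arc of the
annulus, or an asymptotic arc (a lift of a bridging arc of the punctured disc). -/
def Surface.IsArc : Surface → CoverVertex → CoverVertex → Prop
  | _, .outer a, .outer b => a + 2 ≤ b
  | .annulus _ _ _ _, .outer _, .inner _ => True
  | .puncturedDisc _ _, .outer _, .puncture => True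
  | _, _, _ => False

/-- A bridging arc joins the outer boundary to the inner boundary or to the puncture. -/
def Surface.IsBridging (S : Surface) (x y : CoverVertex) : Prop :=
  S.IsArc x y ∧ (∃ k, x = .outer k) ∧ ¬ ∃ l, y = .outer l

/-- A dissection of the surface, given by all lifts of its arcs to the infinite strip. Two lifts
cross if and only if their ends alternate on the boundary of the strip; as this is required for any
two lifts, the arcs of the surface are simple and pairwise disjoint. The arcs cut the surface into
polygons if and only if at least one of them is bridging. -/
structure Surface.Dissection (S : Surface) : Type where
  /-- The lifts of the arcs, each recorded as a pair `(x, y)` with `x < y`. -/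
  arcs : Set (CoverVertex × CoverVertex)
  isArc : ∀ x y, (x, y) ∈ arcs → S.IsArc x y
  deck_mem : ∀ (z : ℤ) (x y), (x, y) ∈ arcs → (S.deck z x, S.deck z y) ∈ arcs
  noncrossing : ∀ a b x y, (a, b) ∈ arcs → (x, y) ∈ arcs → ¬ (a < x ∧ x < b ∧ b < y)
  exists_bridging : ∃ x y, (x, y) ∈ arcs ∧ S.IsBridging x y

/-- For `x < y` in `s`: in the cyclic order, no element of `s` separates `x` and `y` on one of the
two sides, that is, `x` and `y` are neighbours in the polygon with vertex set `s`. -/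
def ConsecutiveIn (s : Finset CoverVertex) (x y : CoverVertex) : Prop :=
  (∀ z ∈ s, ¬ (x < z ∧ z < y)) ∨ (∀ z ∈ s, ¬ (z < x ∨ y < z))

namespace Surface.Dissection

variable {S : Surface} (D : S.Dissection)

/-- `s` is the vertex set of a subgon of the dissected strip: the sides of the polygon with vertex
set `s` are boundary segments or arcs of the dissection, and no diagonal of this polygon is an arc
of the dissection. -/
def IsSubgon (s : Finset CoverVertex) : Prop :=
  3 ≤ s.card ∧ ∀ x ∈ s, ∀ y ∈ s, x < y →
    (ConsecutiveIn s x y → S.IsBoundarySegment x y ∨ (x, y) ∈ D.arcs) ∧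
    (¬ ConsecutiveIn s x y → (x, y) ∉ D.arcs)

/-- The subgons of the dissected strip. -/
def CoverSubgon : Type := {s : Finset CoverVertex // D.IsSubgon s}

/-- The number of vertices of a subgon, which is also the number of its sides. -/
def CoverSubgon.size {D : S.Dissection} (P : D.CoverSubgon) : ℕ := P.1.card

/-- Two subgons of the strip lie over the same subgon of the surface if and only if a deck
transformation carries one to the other. -/
def liftSetoid : Setoid D.CoverSubgon where
  r P Q := ∃ z : ℤ, Q.1 = P.1.map (S.deck z).toEmbedding
  iseqv :=
    { refl := fun P => ⟨0, by simp [Surface.deck_zero]⟩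
      symm := by
        rintro P Q ⟨z, hz⟩
        refine ⟨-z, ?_⟩
        rw [hz, Finset.map_map]
        have h : (S.deck z).toEmbedding.trans (S.deck (-z)).toEmbedding =
            (Equiv.refl CoverVertex).toEmbedding := by
          rw [← S.deck_zero, ← add_neg_cancel z, S.deck_add]; rfl
        rw [h]; simp
      trans := by
        rintro P Q R ⟨y, hy⟩ ⟨z, hz⟩
        refine ⟨y + z, ?_⟩
        rw [hz, hy, Finset.map_map, S.deck_add]; rfl }

/-- The subgons of the dissected surface. -/
def Subgon : Type := Quotient D.liftSetoid

/-- The number of edges of a subgon of the surface; an edge that bounds the subgon from both sides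
counts twice. -/
def Subgon.size {D : S.Dissection} : D.Subgon → ℕ :=
  Quotient.lift CoverSubgon.size (by
    rintro P Q ⟨z, hz⟩
    simp [CoverSubgon.size, hz])

/-- The covering map on subgons. -/
def CoverSubgon.proj {D : S.Dissection} (P : D.CoverSubgon) : D.Subgon :=
  Quotient.mk D.liftSetoid P

/-- The subgons of the strip that are incident to the vertex `outer k`. They correspond to the
subgons met by a small half circle around `v_k` in the surface, counted with multiplicity. -/
def SubgonsAt (k : ℤ) : Type := {P : D.CoverSubgon // CoverVertex.outer k ∈ P.1}

/-- A side of a subgon does not cross an arc of the dissection. -/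
lemma side_not_crossing {x y a b : CoverVertex}
    (h : S.IsBoundarySegment x y ∨ (x, y) ∈ D.arcs) (hab : (a, b) ∈ D.arcs) :
    ¬ (a < x ∧ x < b ∧ b < y) ∧ ¬ (x < a ∧ a < y ∧ y < b) := by
  rcases h with h | h
  · exact ⟨fun ⟨_, h1, h2⟩ => h.not_between h1 h2, fun ⟨h1, h2, _⟩ => h.not_between h1 h2⟩
  · exact ⟨D.noncrossing _ _ _ _ hab h, D.noncrossing _ _ _ _ h hab⟩

/-- An arc of the dissection does not separate two vertices of a subgon. -/
lemma not_separated {s : Finset CoverVertex} (hs : D.IsSubgon s) {a b u v : CoverVertex}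
    (hab : (a, b) ∈ D.arcs) (hu : u ∈ s) (hau : a < u) (hub : u < b) (hv : v ∈ s)
    (hvo : v < a ∨ b < v) : False := by
  have side : ∀ x ∈ s, ∀ y ∈ s, x < y → ConsecutiveIn s x y →
      ¬ (a < x ∧ x < b ∧ b < y) ∧ ¬ (x < a ∧ a < y ∧ y < b) := fun x hx y hy hxy hc =>
    D.side_not_crossing ((hs.2 x hx y hy hxy).1 hc) hab
  obtain ⟨i₀, hi₀, hmin⟩ := (s.filter fun z => a < z ∧ z < b).exists_minimal
    ⟨u, by simp [hu, hau, hub]⟩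
  obtain ⟨i₁, hi₁, hmax⟩ := (s.filter fun z => a < z ∧ z < b).exists_maximal
    ⟨u, by simp [hu, hau, hub]⟩
  simp only [Finset.mem_filter] at hi₀ hi₁ hmin hmax
  obtain ⟨hi₀s, hai₀, hi₀b⟩ := hi₀
  obtain ⟨hi₁s, hai₁, hi₁b⟩ := hi₁
  have hA : (∃ z ∈ s, z < i₀) → a ∈ s := by
    rintro ⟨z, hz, hzi⟩
    obtain ⟨q, hq, hqmax⟩ := (s.filter fun z => z < i₀).exists_maximal ⟨z, by simp [hz, hzi]⟩
    simp only [Finset.mem_filter] at hq hqmax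
    have hqa : q ≤ a := by
      by_contra hlt
      exact absurd (hmin ⟨hq.1, not_le.1 hlt, hq.2.trans hi₀b⟩ hq.2.le) (not_le.2 hq.2)
    rcases hqa.lt_or_eq with hlt | rfl
    · refine absurd ⟨hlt, hai₀, hi₀b⟩ (side q hq.1 i₀ hi₀s hq.2 (Or.inl ?_)).2
      rintro y hy ⟨h1, h2⟩
      exact absurd (hqmax ⟨hy, h2⟩ h1.le) (not_le.2 h1)
    · exact hq.1
  have hB : (∃ z ∈ s, i₁ < z) → b ∈ s := by
    rintro ⟨z, hz, hzi⟩
    obtain ⟨q, hq, hqmin⟩ := (s.filter fun z => i₁ < z).exists_minimal ⟨z, by simp [hz, hzi]⟩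
    simp only [Finset.mem_filter] at hq hqmin
    have hqb : b ≤ q := by
      by_contra hlt
      exact absurd (hmax ⟨hq.1, hai₁.trans hq.2, not_le.1 hlt⟩ hq.2.le) (not_le.2 hq.2)
    rcases hqb.lt_or_eq with hlt | rfl
    · refine absurd ⟨hai₁, hi₁b, hlt⟩ (side i₁ hi₁s q hq.1 hq.2 (Or.inl ?_)).1
      rintro y hy ⟨h1, h2⟩
      exact absurd (hqmin ⟨hy, h1⟩ h2.le) (not_le.2 h2)
    · exact hq.1
  obtain ⟨lo, hlo, hlomin⟩ := s.exists_minimal ⟨u, hu⟩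
  obtain ⟨hi, hhi, hhimax⟩ := s.exists_maximal ⟨u, hu⟩
  have hlo' : ∀ z ∈ s, lo ≤ z := fun z hz => by
    by_contra h
    exact h (hlomin hz (not_le.1 h).le)
  have hhi' : ∀ z ∈ s, z ≤ hi := fun z hz => by
    by_contra h
    exact h (hhimax hz (not_le.1 h).le)
  by_cases h0 : ∃ z ∈ s, z < i₀ <;> by_cases h1 : ∃ z ∈ s, i₁ < z
  · refine (hs.2 a (hA h0) b (hB h1) (hau.trans hub)).2 ?_ hab
    rintro (h | h)
    · exact h u hu ⟨hau, hub⟩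
    · exact h v hv hvo
  · have hva : v < a := hvo.resolve_right fun h => h1 ⟨v, hv, hi₁b.trans h⟩
    have hloa : lo < a := (hlo' v hv).trans_lt hva
    refine (side lo hlo i₁ hi₁s (hloa.trans hai₁) (Or.inr ?_)).2 ⟨hloa, hai₁, hi₁b⟩
    rintro z hz (h | h)
    · exact not_le.2 h (hlo' z hz)
    · exact h1 ⟨z, hz, h⟩
  · have hvb : b < v := hvo.resolve_left fun h => h0 ⟨v, hv, h.trans hai₀⟩
    have hbhi : b < hi := hvb.trans_le (hhi' v hv)
    refine (side i₀ hi₀s hi hhi (hi₀b.trans hbhi) (Or.inr ?_)).1 ⟨hai₀, hi₀b, hbhi⟩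
    rintro z hz (h | h)
    · exact h0 ⟨z, hz, h⟩
    · exact not_le.2 h (hhi' z hz)
  · rcases hvo with h | h
    · exact h0 ⟨v, hv, h.trans hai₀⟩
    · exact h1 ⟨v, hv, hi₁b.trans h⟩

/-- Only finitely many subgons of the strip are incident to a given vertex. -/
lemma finite_subgonsAt (k : ℤ) : Finite (D.SubgonsAt k) := by
  obtain ⟨x, y, hxy, harc, ⟨p, rfl⟩, hy⟩ := D.exists_bridging
  have hn : (1 : ℤ) ≤ S.n := by exact_mod_cast S.one_le_n
  have hp : p + -(|k - p| + 1) * S.n < k := by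
    nlinarith [neg_abs_le (k - p), abs_nonneg (k - p)]
  have hq : k < p + (|k - p| + 1) * S.n := by
    nlinarith [le_abs_self (k - p), abs_nonneg (k - p)]
  have h₁ := D.deck_mem (-(|k - p| + 1)) _ _ hxy
  have h₂ := D.deck_mem (|k - p| + 1) _ _ hxy
  generalize -(|k - p| + 1) = z₁ at hp h₁
  generalize |k - p| + 1 = z₂ at hq h₂
  have key : ∃ W : Set CoverVertex, W.Finite ∧
      ∀ P : D.SubgonsAt k, ∀ v ∈ P.1.1, v ∈ W := by
    have lower : ∀ P : D.SubgonsAt k, ∀ v ∈ P.1.1,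
        CoverVertex.outer k < S.deck z₁ y →
        .outer (p + z₁ * S.n) ≤ v ∧ v ≤ S.deck z₁ y := by
      intro P v hv hk
      have := fun h => D.not_separated P.1.2 h₁ P.2
        (CoverVertex.outer_lt_outer.2 hp) hk hv h
      exact ⟨not_lt.1 fun h => this (Or.inl h), not_lt.1 fun h => this (Or.inr h)⟩
    have upper : ∀ P : D.SubgonsAt k, ∀ v ∈ P.1.1,
        ¬ (.outer (p + z₂ * S.n) < v ∧ v < S.deck z₂ y) := by
      rintro P v hv ⟨h, h'⟩
      exact D.not_separated P.1.2 h₂ hv h h' P.2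
        (Or.inl (CoverVertex.outer_lt_outer.2 hq))
    cases S with
    | annulus n m hn hm =>
      cases y with
      | outer l => exact absurd ⟨l, rfl⟩ hy
      | puncture => exact harc.elim
      | inner l =>
        refine ⟨CoverVertex.outer '' Set.Icc (p + z₁ * n) (p + z₂ * n) ∪
          CoverVertex.inner '' Set.Icc (l + z₁ * m) (l + z₂ * m),
          ((Set.finite_Icc _ _).image _).union ((Set.finite_Icc _ _).image _), ?_⟩
        intro P v hv
        have h3 := lower P v hv CoverVertex.outer_lt_inner
        have h4 := upper P v hv
        simp only [Surface.deck, Surface.n, Equiv.coe_fn_mk] at h3 h4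
        cases v with
        | outer j =>
          left
          refine ⟨j, ⟨?_, ?_⟩, rfl⟩
          · exact not_lt.1 fun h => not_lt.2 h3.1 (CoverVertex.outer_lt_outer.2 h)
          · exact not_lt.1 fun h => h4 ⟨CoverVertex.outer_lt_outer.2 h, CoverVertex.outer_lt_inner⟩
        | inner j =>
          right
          refine ⟨j, ⟨?_, ?_⟩, rfl⟩
          · exact not_lt.1 fun h => not_lt.2 h3.2 (CoverVertex.inner_lt_inner.2 h)
          · exact not_lt.1 fun h => h4 ⟨CoverVertex.outer_lt_inner, CoverVertex.inner_lt_inner.2 h⟩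
        | puncture => exact absurd CoverVertex.inner_lt_puncture (not_lt.2 h3.2)
    | puncturedDisc n hn =>
      cases y with
      | outer l => exact absurd ⟨l, rfl⟩ hy
      | inner l => exact harc.elim
      | puncture =>
        refine ⟨CoverVertex.outer '' Set.Icc (p + z₁ * n) (p + z₂ * n) ∪ {.puncture},
          ((Set.finite_Icc _ _).image _).union (Set.finite_singleton _), ?_⟩
        intro P v hv
        have h3 := lower P v hv CoverVertex.outer_lt_puncture
        have h4 := upper P v hv
        simp only [Surface.deck, Surface.n, Equiv.coe_fn_mk] at h3 h4
        cases v with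
        | outer j =>
          left
          refine ⟨j, ⟨?_, ?_⟩, rfl⟩
          · exact not_lt.1 fun h => not_lt.2 h3.1 (CoverVertex.outer_lt_outer.2 h)
          · exact not_lt.1 fun h =>
              h4 ⟨CoverVertex.outer_lt_outer.2 h, CoverVertex.outer_lt_puncture⟩
        | inner j =>
          exact absurd ⟨CoverVertex.outer_lt_inner, CoverVertex.inner_lt_puncture⟩ h4
        | puncture => exact Or.inr rfl
  obtain ⟨W, hW, hsub⟩ := key
  refine Finite.of_injective
    (fun P : D.SubgonsAt k => (⟨P.1.1, ?_⟩ : {s // s ∈ hW.toFinset.powerset})) ?_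
  · rw [Finset.mem_powerset]
    exact fun v hv => hW.mem_toFinset.2 (hsub P v hv)
  · intro P Q h
    exact Subtype.ext (Subtype.ext (Subtype.mk.inj h))

noncomputable instance (k : ℤ) : Fintype (D.SubgonsAt k) :=
  @Fintype.ofFinite _ (D.finite_subgonsAt k)

/-- The matchings between `v_i` and `v_j`, `i < j`, in the infinite strip: a choice, for each `k`
with `i < k < j`, of a subgon of the strip incident to `outer k`. -/
abbrev Matching (i j : ℤ) : Type := (k : Finset.Ioo i j) → D.SubgonsAt k

end Surface.Dissection

/-- `λ_p = 2 cos (π / p)`. -/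
noncomputable def chordRatio (p : ℕ) : ℝ := 2 * Real.cos (Real.pi / p)

/-- `U_k(λ_p)` for the normalized Chebyshev polynomial of the second kind: `U_0 = 1`, `U_1 = X`,
`U_{k+2} = X * U_{k+1} - U_k`. -/
noncomputable def chebyshevValue (k p : ℕ) : ℝ :=
  (Polynomial.Chebyshev.S ℝ k).eval (chordRatio p)

open Classical in
/-- For a subgon `P` of the surface, the number of lifts of `P` among the subgons of a matching. -/
noncomputable def Surface.Dissection.multiplicity {S : Surface} {D : S.Dissection} {i j : ℤ}
    (w : D.Matching i j) (P : D.Subgon) : ℕ :=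
  (Finset.univ.filter fun k => (w k).1.proj = P).card

open Classical in
/-- The annulus weight of a matching (of length `n`). The product over all subgons `P` of the surface
has only finitely many factors other than `1`, since `U_0 = 1`. -/
noncomputable def Surface.Dissection.annulusWeight {S : Surface} {D : S.Dissection} {i j : ℤ}
    (w : D.Matching i j) : ℝ :=
  if ∃ P : D.Subgon, P.size < multiplicity w P + 2 then 0
  else ∏ᶠ P : D.Subgon, chebyshevValue (multiplicity w P) P.size

/-- `m` is an infinite frieze pattern of real numbers; only the entries `m i j` with `i ≤ j` belong
to the pattern. -/
structure IsInfiniteFrieze (m : ℤ → ℤ → ℝ) : Prop where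
  row_zero : ∀ i, m i i = 0
  row_one : ∀ i, m i (i + 1) = 1
  diamond : ∀ i j, i ≤ j → m (i - 1) j * m i (j + 1) - m i j * m (i - 1) (j + 1) = 1

/-- The pattern `m` comes from the dissection `D`: its quiddity row is given by
`m_{i-1,i+1} = ∑ λ_{|P|}`, the sum over the subgons incident to `v_i`. -/
def Surface.Dissection.Realizes {S : Surface} (D : S.Dissection) (m : ℤ → ℤ → ℝ) : Prop :=
  ∀ i : ℤ, m (i - 1) (i + 1) = ∑ P : D.SubgonsAt i, chordRatio P.1.size

/-- The principal growth coefficient `s_1 = m_{0,n+1} - m_{1,n}` of an infinite frieze pattern of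
period `n`. -/
def principalGrowthCoefficient (n : ℕ) (m : ℤ → ℤ → ℝ) : ℝ := m 0 (n + 1) - m 1 n

/-! ### Trigonometric facts about `chordRatio` and `chebyshevValue` -/

/-! Cut the strip along a lift of a bridging arc at `outer k₀` and along its first translate. The
region in between is a dissected polygon with vertices `0, …, N`, of which `0, …, n` lie on the
lower boundary and `0` and `n` are two copies of `v_{k₀}`. Its subgons correspond injectively to
subgons of the surface (`proj_subgon_injective`). The entry of the quiddity row at `k₀` splits into
the quiddities of the polygon at `0` and at `n` (`sumAt_zero`).

The weight of a matching depends only on how often each subgon is chosen. It is therefore the value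
on a monomial of the linear functional sending `∏ X_P ^ k_P` to the product of the truncated
Chebyshev weights, and the sum over all matchings is this functional applied to a product of sums of
variables (`sum_annulusWeight`). This product is invariant under shifts, so it may be taken from
`k₀` on. Splitting the factor at `k₀` gives two products in the polygon, one over `0, …, n - 1` and
one over `1, …, n`.

In the polygon, a counting argument forces every subgon with all vertices up to `n` to be chosen
exactly at its inner vertices, with weight `U_{p-2}(λ_p) = 1`. For the other subgons the truncation
is automatic, since `U_{p-1}(λ_p) = 0` (`truncated_eq_bridging`). What remains obeys, by the
three-term recurrence of the Chebyshev polynomials, the recurrence given by the quiddity cycle after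
contracting it along edges (`bridgingSum_succ`, `solution_below_edge`). Hence both products are
values of solutions of that recurrence (`bridgingSum_eq_solution`), and written as continuants they
add up to the growth coefficient (`weightFunctional_add_eq_growth`).

Finally, the frieze entries are continuants of the quiddity row. The diamond rule determines them
only if no divisor vanishes, which follows from a positive solution of the recurrence on a
sufficiently wide window (`continuant_quiddity_pos`). -/

lemma sin_pi_div_pos {p : ℕ} (hp : 2 ≤ p) : 0 < Real.sin (Real.pi / p) := by
  have h2 : (2 : ℝ) ≤ p := by exact_mod_cast hp
  refine Real.sin_pos_of_pos_of_lt_pi (by positivity) ?_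
  rw [div_lt_iff₀ (by linarith)]
  nlinarith [Real.pi_pos]

/-- The Chebyshev weights, set to zero if a subgon is chosen too often. -/
noncomputable def truncatedWeight (p k : ℕ) : ℝ := if p < k + 2 then 0 else chebyshevValue k p

lemma chebyshevValue_zero (p : ℕ) : chebyshevValue 0 p = 1 := by
  simp [chebyshevValue]

lemma chebyshevValue_one (p : ℕ) : chebyshevValue 1 p = chordRatio p := by
  simp [chebyshevValue]

lemma chebyshevValue_add_two (k p : ℕ) :
    chebyshevValue (k + 2) p =
      chordRatio p * chebyshevValue (k + 1) p - chebyshevValue k p := by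
  simp only [chebyshevValue]
  push_cast
  rw [Polynomial.Chebyshev.S_add_two]
  simp

lemma chebyshevValue_mul_sin (k p : ℕ) :
    chebyshevValue k p * Real.sin (Real.pi / p) = Real.sin ((k + 1) * (Real.pi / p)) := by
  induction k using Nat.twoStepInduction with
  | zero => simp [chebyshevValue_zero]
  | one =>
    rw [chebyshevValue_one, chordRatio]
    have : ((1 : ℕ) + 1 : ℝ) * (Real.pi / p) = 2 * (Real.pi / p) := by norm_num
    rw [this, Real.sin_two_mul]
    ring
  | more k h1 h2 =>
    rw [chebyshevValue_add_two, sub_mul, h1, mul_assoc, h2, chordRatio]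
    have e1 : ((k + 2 : ℕ) + 1 : ℝ) * (Real.pi / p) =
        ((k + 1 : ℕ) + 1 : ℝ) * (Real.pi / p) + Real.pi / p := by push_cast; ring
    have e2 : ((k : ℝ) + 1) * (Real.pi / p) =
        ((k + 1 : ℕ) + 1 : ℝ) * (Real.pi / p) - Real.pi / p := by push_cast; ring
    rw [e1, e2, Real.sin_add, Real.sin_sub]
    ring

/-- A subgon chosen as often as the bound allows has weight 1, because `sin (π - π / p) = sin (π /
p)`. -/
lemma chebyshevValue_sub_two {p : ℕ} (hp : 2 ≤ p) : chebyshevValue (p - 2) p = 1 := by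
  have hs := sin_pi_div_pos hp
  have h := chebyshevValue_mul_sin (p - 2) p
  have hp0 : (p : ℝ) ≠ 0 := by positivity
  have e : (((p - 2 : ℕ) : ℝ) + 1) * (Real.pi / p) = Real.pi - Real.pi / p := by
    rw [Nat.cast_sub hp]; field_simp; push_cast; ring
  rw [e, Real.sin_pi_sub] at h
  exact mul_right_cancel₀ hs.ne' (by rw [h, one_mul])

/-- This zero makes the truncation harmless when a subgon is chosen just once too often. -/
lemma chebyshevValue_sub_one {p : ℕ} (hp : 2 ≤ p) : chebyshevValue (p - 1) p = 0 := by
  have hs := sin_pi_div_pos hp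
  have h := chebyshevValue_mul_sin (p - 1) p
  have hp0 : (p : ℝ) ≠ 0 := by positivity
  have e : (((p - 1 : ℕ) : ℝ) + 1) * (Real.pi / p) = Real.pi := by
    rw [Nat.cast_sub (by omega)]; field_simp; push_cast; ring
  rw [e, Real.sin_pi] at h
  exact (mul_eq_zero.1 h).resolve_right hs.ne'

/-- A solution of `G (j + 2) = λ_p G (j + 1) - G j` along a `p`-gon. -/
lemma polygon_solution {p : ℕ} (hp : 3 ≤ p) {G : ℕ → ℝ}
    (hG : ∀ j, j + 2 < p → G j + G (j + 2) = chordRatio p * G (j + 1)) :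
    G 1 - chordRatio p * G 0 = G (p - 1) ∧
    G (p - 2) - chordRatio p * G (p - 1) = G 0 ∧
    (0 < G 0 → 0 < G (p - 1) → ∀ j < p, 0 < G j) := by
  have hs := sin_pi_div_pos (p := p) (by omega)
  have hpR : (3 : ℝ) ≤ p := by exact_mod_cast hp
  have hp0 : (p : ℝ) ≠ 0 := by positivity
  set θ := Real.pi / p with hθ
  have hpθ : p * θ = Real.pi := by rw [hθ]; field_simp
  -- The solution in terms of its values at `0` and `1`, with sines as fundamental solutions.
  have key : ∀ j : ℕ, j < p → G j * Real.sin θ =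
      G 1 * Real.sin (j * θ) - G 0 * Real.sin ((j - 1) * θ) := by
    intro j
    induction j using Nat.twoStepInduction with
    | zero => intro _; simp
    | one => intro _; simp
    | more j h1 h2 =>
      intro hj
      have e := hG j (by omega)
      have h1 := h1 (by omega)
      have h2 := h2 (by omega)
      have e1 : ((j + 2 : ℕ) : ℝ) * θ = ((j + 1 : ℕ) : ℝ) * θ + θ := by push_cast; ring
      have e2 : (j : ℝ) * θ = ((j + 1 : ℕ) : ℝ) * θ - θ := by push_cast; ring
      have e3 : (((j + 2 : ℕ) : ℝ) - 1) * θ = (((j + 1 : ℕ) : ℝ) - 1) * θ + θ := by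
        push_cast; ring
      have e4 : ((j : ℝ) - 1) * θ = (((j + 1 : ℕ) : ℝ) - 1) * θ - θ := by push_cast; ring
      rw [e2, e4, Real.sin_sub, Real.sin_sub] at h1
      rw [e1, e3, Real.sin_add, Real.sin_add]
      have : G (j + 2) = 2 * Real.cos θ * G (j + 1) - G j := by
        rw [chordRatio, ← hθ] at e; linarith
      rw [this]
      linear_combination 2 * Real.cos θ * h2 - h1
  have e1 : ((p - 1 : ℕ) : ℝ) * θ = Real.pi - θ := by
    rw [Nat.cast_sub (by omega), sub_mul, hpθ]; simp
  have e2 : (((p - 1 : ℕ) : ℝ) - 1) * θ = Real.pi - 2 * θ := by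
    rw [Nat.cast_sub (by omega)]; push_cast; rw [← hpθ]; ring
  have h1 := key (p - 1) (by omega)
  rw [e1, e2, Real.sin_pi_sub, Real.sin_pi_sub, Real.sin_two_mul] at h1
  -- Since `p * θ = π`, solutions change sign after `p` steps; this is the recurrence at `0` with `G
  -- (-1) = -G (p - 1)`.
  have r1 : G 1 - chordRatio p * G 0 = G (p - 1) := by
    refine mul_right_cancel₀ hs.ne' ?_
    rw [chordRatio, ← hθ]; linear_combination -h1
  -- In terms of the values at `0` and `p - 1` both coefficients are sines of angles in `[0, π]`, so
  -- positivity can be read off.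
  have key2 : ∀ j : ℕ, j < p → G j * Real.sin θ =
      G (p - 1) * Real.sin (j * θ) + G 0 * Real.sin ((j + 1) * θ) := by
    intro j hj
    rw [key j hj, ← r1, chordRatio, ← hθ, sub_mul (j : ℝ), add_mul (j : ℝ), one_mul,
      Real.sin_sub, Real.sin_add]
    ring
  refine ⟨r1, ?_, ?_⟩
  · have h2 := key2 (p - 2) (by omega)
    have e3 : ((p - 2 : ℕ) : ℝ) * θ = Real.pi - 2 * θ := by
      rw [Nat.cast_sub (by omega)]; push_cast; rw [← hpθ]; ring
    have e4 : (((p - 2 : ℕ) : ℝ) + 1) * θ = Real.pi - θ := by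
      rw [Nat.cast_sub (by omega)]; push_cast; rw [← hpθ]; ring
    rw [e3, e4, Real.sin_pi_sub, Real.sin_pi_sub, Real.sin_two_mul] at h2
    refine mul_right_cancel₀ hs.ne' ?_
    rw [chordRatio, ← hθ]; linear_combination h2
  · intro h0 hp1 j hj
    have hθ0 : 0 < θ := by positivity
    rcases Nat.eq_zero_or_pos j with rfl | hj0
    · exact h0
    rcases Nat.eq_or_lt_of_le (Nat.le_sub_one_of_lt hj) with rfl | hj1
    · exact hp1
    have hj0' : (0 : ℝ) < j := by exact_mod_cast hj0
    have hjp : (j : ℝ) + 1 < p := by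
      have : j + 1 < p := by omega
      exact_mod_cast this
    have s1 : 0 < Real.sin (j * θ) :=
      Real.sin_pos_of_pos_of_lt_pi (by positivity) (by rw [← hpθ]; nlinarith)
    have s2 : 0 < Real.sin ((j + 1) * θ) :=
      Real.sin_pos_of_pos_of_lt_pi (by positivity) (by rw [← hpθ]; nlinarith)
    have := key2 j hj
    exact pos_of_mul_pos_left (this ▸ by positivity) hs.le

/-- The elements of a finite set of integers, enumerated in increasing order. -/
lemma Finset.exists_enumeration (s : Finset ℤ) : ∃ q : ℕ → ℤ,
    (∀ j < s.card, q j ∈ s) ∧ (∀ z ∈ s, ∃ j < s.card, q j = z) ∧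
    ∀ i j, i < j → j < s.card → q i < q j := by
  let e := s.orderEmbOfFin rfl
  refine ⟨fun j => if h : j < s.card then e ⟨j, h⟩ else 0, ?_, ?_, ?_⟩
  · intro j hj
    simp only [hj, dif_pos]
    exact s.orderEmbOfFin_mem rfl _
  · intro z hz
    have : z ∈ Set.range e := by rw [s.range_orderEmbOfFin rfl]; exact hz
    obtain ⟨j, rfl⟩ := this
    exact ⟨j, j.2, by simp⟩
  · intro i j hij hj
    simp only [hj, hij.trans hj, dif_pos]
    exact e.strictMono hij

/-! ### Dissected polygons -/

/-- A dissected polygon with vertices `0, …, N`, given by its sides and diagonals, all called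
edges. -/
structure PolygonDissection (N : ℤ) where
  /-- The sides of the polygon and the diagonals of the dissection. -/
  edge : ℤ → ℤ → Prop
  range : ∀ {a b}, edge a b → 0 ≤ a ∧ a < b ∧ b ≤ N
  step : ∀ {a}, 0 ≤ a → a < N → edge a (a + 1)
  root : edge 0 N
  noncrossing : ∀ {a b x y}, edge a b → edge x y → ¬ (a < x ∧ x < b ∧ b < y)

namespace PolygonDissection

variable {N : ℤ} (G : PolygonDissection N)

open Classical in
/-- The vertices of the subgon whose longest side is the edge from `a` to `c`. -/
noncomputable def top (a c : ℤ) : Finset ℤ :=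
  (Finset.Icc a c).filter fun k =>
    ∀ x y, G.edge x y → a ≤ x → y ≤ c → x < k → k < y → x = a ∧ y = c

variable {G}

lemma mem_top {a c k : ℤ} : k ∈ G.top a c ↔ (a ≤ k ∧ k ≤ c) ∧
    ∀ x y, G.edge x y → a ≤ x → y ≤ c → x < k → k < y → x = a ∧ y = c := by
  simp [top]

lemma left_mem_top {a c : ℤ} (h : a ≤ c) : a ∈ G.top a c :=
  mem_top.2 ⟨⟨le_rfl, h⟩, fun x y _ h1 _ h3 _ => by omega⟩

lemma right_mem_top {a c : ℤ} (h : a ≤ c) : c ∈ G.top a c :=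
  mem_top.2 ⟨⟨h, le_rfl⟩, fun x y _ h1 _ h3 _ => by omega⟩

/-- If `y` is not `x + 1`, the longest edge starting at `x` below, and different from, the edge from
`a` to `c` ends at a vertex of the subgon, by noncrossing; this end must be `y`. That the edge found
is not the one from `a` to `c` yields a third vertex and lets inductions on edges descend. -/
lemma edge_of_consecutive {a c x y : ℤ} (hac : G.edge a c) (hac2 : a + 2 ≤ c) (hxy : x < y)
    (hx : x ∈ G.top a c) (hy : y ∈ G.top a c) (h : ∀ z ∈ G.top a c, ¬ (x < z ∧ z < y)) :
    G.edge x y ∧ ¬ (x = a ∧ y = c) := by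
  classical
  have hr := G.range hac
  rw [mem_top] at hx hy
  by_cases hs : y = x + 1
  · subst hs
    exact ⟨G.step (by omega) (by omega), by omega⟩
  have h1 : x + 1 ∉ G.top a c := fun h' => h _ h' (by omega)
  rw [mem_top] at h1
  push Not at h1
  obtain ⟨x', y', he, h3, h4, h5, h6, h7⟩ := h1 (by omega)
  have hx' : x' = x := by
    by_contra hne
    have := hx.2 x' y' he h3 h4 (by omega) (by omega)
    exact h7 this.1 this.2
  subst hx'
  set T := (Finset.Icc (x' + 2) c).filter fun y => G.edge x' y ∧ ¬ (x' = a ∧ y = c) with hT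
  have hne : T.Nonempty := ⟨y', by
    simp only [hT, Finset.mem_filter, Finset.mem_Icc]
    exact ⟨by omega, he, fun h => h7 h.1 h.2⟩⟩
  have hmem := T.max'_mem hne
  have hmax := T.le_max'
  set t := T.max' hne
  simp only [hT, Finset.mem_filter, Finset.mem_Icc] at hmem
  obtain ⟨⟨ht1, ht2⟩, ht3, ht4⟩ := hmem
  have hty : t ≤ y := by
    by_contra hlt
    exact ht4 (hy.2 _ _ ht3 (by omega) ht2 (by omega) (by omega))
  have htop : t ∈ G.top a c := by
    rw [mem_top]
    refine ⟨by omega, fun u v huv hu hv hut htv => ?_⟩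
    by_contra hne'
    have hux : u ≤ x' := by
      by_contra hlt
      exact G.noncrossing ht3 huv (by omega)
    rcases hux.lt_or_eq with hlt | rfl
    · exact hne' (hx.2 u v huv hu hv hlt (by omega))
    · have := hmax v (by
        simp only [hT, Finset.mem_filter, Finset.mem_Icc]
        exact ⟨by omega, huv, hne'⟩)
      omega
  have : t = y := by
    by_contra hne'
    exact h t htop (by omega)
  subst this
  exact ⟨ht3, ht4⟩

lemma three_le_card_top {a c : ℤ} (hac : G.edge a c) (hac2 : a + 2 ≤ c) :
    3 ≤ (G.top a c).card := by
  by_contra hlt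
  have ha := left_mem_top (G := G) (show a ≤ c by omega)
  have hc := right_mem_top (G := G) (show a ≤ c by omega)
  refine (edge_of_consecutive hac hac2 (by omega) ha hc ?_).2 ⟨rfl, rfl⟩
  rintro z hz ⟨h1, h2⟩
  apply hlt
  calc 3 = ({a, z, c} : Finset ℤ).card := by
        rw [Finset.card_insert_of_notMem, Finset.card_insert_of_notMem] <;> simp <;> omega
    _ ≤ _ := Finset.card_le_card (by
      intro w hw
      simp only [Finset.mem_insert, Finset.mem_singleton] at hw
      rcases hw with rfl | rfl | rfl <;> assumption)

variable (G)

/-- The subgons of a dissected polygon, each given by its longest side. -/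
def Cell : Type := {e : ℤ × ℤ // G.edge e.1 e.2 ∧ e.1 + 2 ≤ e.2}

instance : Finite G.Cell := by
  refine Finite.of_injective
    (fun e : G.Cell => (⟨e.1, ?_⟩ : {e // e ∈ Finset.Icc (0 : ℤ) N ×ˢ Finset.Icc (0 : ℤ) N})) ?_
  · have := G.range e.2.1
    simp only [Finset.mem_product, Finset.mem_Icc]
    omega
  · intro e f h
    exact Subtype.ext (Subtype.mk.inj h)

noncomputable instance : Fintype G.Cell := Fintype.ofFinite _

noncomputable instance : DecidableEq G.Cell := Classical.decEq _

variable {G}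

namespace Cell

/-- The vertices of a subgon. -/
noncomputable def verts (e : G.Cell) : Finset ℤ := G.top e.1.1 e.1.2

/-- The number of vertices of a subgon. -/
noncomputable def size (e : G.Cell) : ℕ := e.verts.card

lemma three_le_size (e : G.Cell) : 3 ≤ e.size := three_le_card_top e.2.1 e.2.2

lemma mem_verts {e : G.Cell} {k : ℤ} : k ∈ e.verts ↔ (e.1.1 ≤ k ∧ k ≤ e.1.2) ∧
    ∀ x y, G.edge x y → e.1.1 ≤ x → y ≤ e.1.2 → x < k → k < y → x = e.1.1 ∧ y = e.1.2 := mem_top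

lemma ext' {e f : G.Cell} (h1 : e.1.1 = f.1.1) (h2 : e.1.2 = f.1.2) : e = f :=
  Subtype.ext (Prod.ext h1 h2)

/-- A vertex is an inner vertex of at most one subgon. -/
lemma eq_of_strict {e f : G.Cell} {k : ℤ} (he : k ∈ e.verts) (hf : k ∈ f.verts)
    (he1 : e.1.1 < k) (he2 : k < e.1.2) (hf1 : f.1.1 < k) (hf2 : k < f.1.2) : e = f := by
  have h1 := G.noncrossing e.2.1 f.2.1
  have h2 := G.noncrossing f.2.1 e.2.1
  rw [mem_verts] at he hf
  by_cases h : e.1.1 ≤ f.1.1 ∧ f.1.2 ≤ e.1.2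
  · have := he.2 _ _ f.2.1 h.1 h.2 hf1 hf2
    exact ext' this.1.symm this.2.symm
  · have := hf.2 _ _ e.2.1 (by omega) (by omega) he1 he2
    exact ext' this.1 this.2

/-- A subgon with a vertex strictly below an edge is contained in the part below this edge. -/
lemma subset_of_mem {e : G.Cell} {a c k : ℤ} (hac : G.edge a c) (hk : k ∈ e.verts) (h1 : a < k)
    (h2 : k < c) : a ≤ e.1.1 ∧ e.1.2 ≤ c := by
  have h3 := G.noncrossing e.2.1 hac
  have h4 := G.noncrossing hac e.2.1
  rw [mem_verts] at hk
  by_contra hne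
  have := hk.2 a c hac (by omega) (by omega) h1 h2
  omega

lemma lt (e : G.Cell) : e.1.1 < e.1.2 := by have := e.2.2; omega

lemma left_mem (e : G.Cell) : e.1.1 ∈ e.verts := left_mem_top e.lt.le

lemma right_mem (e : G.Cell) : e.1.2 ∈ e.verts := right_mem_top e.lt.le

end Cell

/-- Every vertex strictly below an edge is an inner vertex of a subgon below this edge. -/
lemma exists_strict {a c k : ℤ} (hac : G.edge a c) (h1 : a < k) (h2 : k < c) :
    ∃ e : G.Cell, k ∈ e.verts ∧ e.1.1 < k ∧ k < e.1.2 ∧ a ≤ e.1.1 ∧ e.1.2 ≤ c := by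
  classical
  -- Descent on the length of the edge: if `k` is not a vertex of the subgon directly below it, a
  -- shorter edge hides `k`.
  have key : ∀ d : ℕ, ∀ a c, G.edge a c → a < k → k < c → (c - a).toNat = d →
      ∃ e : G.Cell, k ∈ e.verts ∧ e.1.1 < k ∧ k < e.1.2 ∧ a ≤ e.1.1 ∧ e.1.2 ≤ c := by
    intro d
    induction d using Nat.strong_induction_on with
    | _ d ih =>
      intro a c hac h1 h2 hd
      by_cases hk : k ∈ G.top a c
      · exact ⟨⟨(a, c), hac, by simp only; omega⟩, hk, h1, h2, le_rfl, le_rfl⟩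
      · have hk' : ∃ x y, G.edge x y ∧ a ≤ x ∧ y ≤ c ∧ x < k ∧ k < y ∧ ¬ (x = a ∧ y = c) := by
          by_contra hcon
          refine hk (mem_top.2 ⟨⟨h1.le, h2.le⟩, fun x y h3 h4 h5 h6 h7 => ?_⟩)
          by_contra h8
          exact hcon ⟨x, y, h3, h4, h5, h6, h7, h8⟩
        obtain ⟨x, y, he, h3, h4, h5, h6, h7⟩ := hk'
        have hlt : (y - x).toNat < d := by omega
        obtain ⟨e, q1, q2, q3, q4, q5⟩ := ih _ hlt x y he h5 h6 rfl
        exact ⟨e, q1, q2, q3, by omega, by omega⟩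
  exact key _ a c hac h1 h2 rfl

variable (G)

/-- The sum of `λ_{|e|}` over the subgons `e` satisfying a condition. -/
noncomputable def ratioSum (p : G.Cell → Prop) : ℝ :=
  open Classical in ∑ e ∈ Finset.univ.filter p, chordRatio e.size

/-- The entry of the quiddity cycle of a dissected polygon at the vertex `k`. -/
noncomputable def quiddity (k : ℤ) : ℝ := G.ratioSum fun e => k ∈ e.verts

variable {G}

lemma ratioSum_congr {p q : G.Cell → Prop} (h : ∀ e, p e ↔ q e) :
    G.ratioSum p = G.ratioSum q := by
  rw [funext fun e => propext (h e)]

lemma ratioSum_eq_zero {p : G.Cell → Prop} (h : ∀ e, ¬ p e) : G.ratioSum p = 0 := by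
  simp [ratioSum, h]

lemma ratioSum_eq (e : G.Cell) : G.ratioSum (fun f => f = e) = chordRatio e.size := by
  classical
  rw [ratioSum, Finset.sum_eq_single_of_mem e (by simp)]
  intro f hf hne
  exact absurd (Finset.mem_filter.1 hf).2 hne

lemma ratioSum_or {p q r : G.Cell → Prop} (h : ∀ e, p e ↔ q e ∨ r e) (hd : ∀ e, q e → ¬ r e) :
    G.ratioSum p = G.ratioSum q + G.ratioSum r := by
  classical
  rw [ratioSum, ratioSum, ratioSum, ← Finset.sum_union]
  · congr 1
    ext e
    simp [h]
  · rw [Finset.disjoint_filter]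
    exact fun e _ => hd e

/-- A solution of the recurrence given by the quiddity cycle, restricted to the part below an
edge. -/
theorem solution_below_edge {g : ℤ → ℝ} {a c : ℤ} (hac : G.edge a c)
    (hg : ∀ k, a < k → k < c → g (k - 1) + g (k + 1) = G.quiddity k * g k) :
    g (a + 1) - G.ratioSum (fun e => e.1.1 = a ∧ e.1.2 ≤ c) * g a = g c ∧
    g (c - 1) - G.ratioSum (fun e => e.1.2 = c ∧ a ≤ e.1.1) * g c = g a ∧
    (0 < g a → 0 < g c → ∀ k, a ≤ k → k ≤ c → 0 < g k) := by
  obtain ⟨d, hd⟩ : ∃ d, (c - a).toNat = d := ⟨_, rfl⟩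
  induction d using Nat.strong_induction_on generalizing a c with
  | _ d ih =>
  have hr := G.range hac
  by_cases hs : c = a + 1
  · subst hs
    rw [ratioSum_eq_zero (fun e => by have := e.2.2; omega),
      ratioSum_eq_zero (fun e => by have := e.2.2; omega)]
    refine ⟨by ring, by ring_nf, fun h1 h2 k h3 h4 => ?_⟩
    rcases h3.eq_or_lt with rfl | h3
    · exact h1
    · rwa [show k = a + 1 by omega]
  have hac2 : a + 2 ≤ c := by omega
  -- The subgon directly below the edge: its other sides are shorter edges, covered by the induction
  -- hypothesis, and contracting them leaves the recurrence of a regular polygon for the values of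
  -- `g` at its vertices.
  set e₀ : G.Cell := ⟨(a, c), hac, hac2⟩ with he₀
  obtain ⟨q, hq1, hq2, hq3⟩ := (G.top a c).exists_enumeration
  have hp := three_le_card_top hac hac2
  have hsz : (G.top a c).card = e₀.size := rfl
  set p := (G.top a c).card with hpdef
  have hge : ∀ j < p, a ≤ q j ∧ q j ≤ c := fun j hj => (mem_top.1 (hq1 j hj)).1
  have hmono : ∀ i j, i ≤ j → j < p → q i ≤ q j := fun i j hij hj => by
    rcases hij.eq_or_lt with rfl | h
    · exact le_rfl
    · exact (hq3 i j h hj).le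
  have hq0 : q 0 = a := by
    obtain ⟨j, hj, hja⟩ := hq2 a (left_mem_top (by omega))
    have := hmono 0 j (by omega) hj
    have := hge 0 (by omega)
    omega
  have hqp : q (p - 1) = c := by
    obtain ⟨j, hj, hja⟩ := hq2 c (right_mem_top (by omega))
    have := hmono j (p - 1) (by omega) (by omega)
    have := hge (p - 1) (by omega)
    omega
  have hnb : ∀ j, j + 1 < p → ∀ z ∈ G.top a c, ¬ (q j < z ∧ z < q (j + 1)) := by
    rintro j hj z hz ⟨h1, h2⟩
    obtain ⟨i, hi, rfl⟩ := hq2 z hz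
    rcases le_or_gt i j with h | h
    · have := hmono i j h (by omega); omega
    · have := hmono (j + 1) i (by omega) hi; omega
  have hedge : ∀ j, j + 1 < p → G.edge (q j) (q (j + 1)) ∧ ¬ (q j = a ∧ q (j + 1) = c) :=
    fun j hj => edge_of_consecutive hac hac2 (hq3 _ _ (by omega) hj) (hq1 _ (by omega))
      (hq1 _ hj) (hnb j hj)
  have hIH := fun j (hj : j + 1 < p) => ih (q (j + 1) - q j).toNat
    (by
      have := hge j (by omega)
      have := hge (j + 1) hj
      have := (hedge j hj).2
      omega) (hedge j hj).1
    (fun k h1 h2 => hg k (by have := hge j (by omega); omega) (by have := hge _ hj; omega)) rfl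
  -- subgons starting or ending at a vertex of the top subgon
  have hstart : ∀ j, j + 1 < p → ∀ e : G.Cell, e.1.1 = q j → e.1.2 ≤ c → e ≠ e₀ →
      e.1.2 ≤ q (j + 1) := by
    intro j hj e h1 h2 hne
    by_contra hlt
    have h3 := hge j (by omega)
    have h4 := hq3 j (j + 1) (by omega) hj
    have := (mem_top.1 (hq1 (j + 1) hj)).2 _ _ e.2.1 (by omega) h2 (by omega) (by omega)
    exact hne (Cell.ext' this.1 this.2)
  have hend : ∀ j, j + 1 < p → ∀ e : G.Cell, e.1.2 = q (j + 1) → a ≤ e.1.1 → e ≠ e₀ →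
      q j ≤ e.1.1 := by
    intro j hj e h1 h2 hne
    by_contra hlt
    have h3 := hge (j + 1) (by omega)
    have h4 := hq3 j (j + 1) (by omega) hj
    have := (mem_top.1 (hq1 j (by omega))).2 _ _ e.2.1 h2 (by omega) (by omega) (by omega)
    exact hne (Cell.ext' this.1 this.2)
  have hsol := polygon_solution (p := p) hp (G := fun j => g (q j)) (by
    intro j hj
    have h1 := hIH j (by omega)
    have h2 := hIH (j + 1) (by omega)
    have m1 := hq3 j (j + 1) (by omega) (by omega)
    have m2 := hq3 (j + 1) (j + 2) (by omega) (by omega)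
    have g1 := hge j (by omega)
    have g2 := hge (j + 2) (by omega)
    have hrec := hg (q (j + 1)) (by omega) (by omega)
    -- The subgons at `q (j + 1)` are `e₀`, those starting there and those ending there. The last
    -- two kinds are absorbed by the induction hypotheses for the two adjacent sides, so only `λ_p`
    -- remains.
    have hquid : G.quiddity (q (j + 1)) =
        G.ratioSum (fun e => e.1.1 = q (j + 1) ∧ e.1.2 ≤ q (j + 1 + 1)) +
        (G.ratioSum (fun e => e.1.2 = q (j + 1) ∧ q j ≤ e.1.1) + chordRatio p) := by
      rw [hsz, ← ratioSum_eq e₀, quiddity]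
      rw [← ratioSum_or (p := fun e => (e.1.2 = q (j + 1) ∧ q j ≤ e.1.1) ∨ e = e₀)
        (fun e => Iff.rfl)]
      · refine ratioSum_or ?_ ?_
        · intro e
          constructor
          · intro he
            have hb := Cell.subset_of_mem hac he (by omega) (by omega)
            have hb2 := (Cell.mem_verts.1 he).1
            by_cases he0 : e = e₀
            · exact Or.inr (Or.inr he0)
            by_cases s1 : e.1.1 = q (j + 1)
            · exact Or.inl ⟨s1, hstart (j + 1) (by omega) e s1 hb.2 he0⟩
            by_cases s2 : e.1.2 = q (j + 1)
            · exact Or.inr (Or.inl ⟨s2, hend j (by omega) e s2 hb.1 he0⟩)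
            · exact absurd (Cell.eq_of_strict he (f := e₀) (hq1 (j + 1) (by omega)) (by omega)
                (by omega) (by simp only [he₀]; omega) (by simp only [he₀]; omega)) he0
          · rintro (⟨h, -⟩ | ⟨h, -⟩ | rfl)
            · rw [← h]; exact e.left_mem
            · rw [← h]; exact e.right_mem
            · exact hq1 (j + 1) (by omega)
        · rintro e ⟨h3, h4⟩ (⟨h5, h6⟩ | rfl)
          · have := e.lt; omega
          · simp only [he₀] at h3; omega
      · rintro e ⟨h3, h4⟩ rfl
        simp only [he₀] at h3; omega
    rw [hquid] at hrec
    linear_combination hrec - h1.2.1 - h2.1)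
  obtain ⟨s1, s2, s3⟩ := hsol
  simp only [hq0, hqp] at s1 s2
  rw [show chordRatio p = chordRatio e₀.size from rfl] at s1 s2
  refine ⟨?_, ?_, ?_⟩
  · have h1 := (hIH 0 (by omega)).1
    rw [ratioSum_or (q := fun e => e.1.1 = q 0 ∧ e.1.2 ≤ q (0 + 1)) (r := fun e => e = e₀),
      ratioSum_eq]
    · rw [hq0] at h1 ⊢
      linear_combination h1 + s1
    · intro e
      have := hge (0 + 1) (by omega)
      constructor
      · rintro ⟨h3, h4⟩
        by_cases he0 : e = e₀
        · exact Or.inr he0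
        · exact Or.inl ⟨by omega, hstart 0 (by omega) e (by omega) h4 he0⟩
      · rintro (⟨h3, h4⟩ | rfl)
        · exact ⟨by omega, by omega⟩
        · exact ⟨rfl, le_rfl⟩
    · rintro e ⟨h3, h4⟩ rfl
      exact (hedge 0 (by omega)).2 ⟨hq0, by
        have := hge (0 + 1) (by omega); simp only [he₀] at h4; omega⟩
  · have hpp : p - 2 + 1 = p - 1 := by omega
    have h1 := (hIH (p - 2) (by omega)).2.1
    rw [ratioSum_or (q := fun e => e.1.2 = q (p - 2 + 1) ∧ q (p - 2) ≤ e.1.1)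
      (r := fun e => e = e₀), ratioSum_eq]
    · rw [hpp, hqp] at h1 ⊢
      linear_combination h1 + s2
    · intro e
      have := hge (p - 2) (by omega)
      rw [hpp, hqp]
      constructor
      · rintro ⟨h3, h4⟩
        by_cases he0 : e = e₀
        · exact Or.inr he0
        · exact Or.inl ⟨by omega, hend (p - 2) (by omega) e (by rw [hpp, hqp, h3]) h4 he0⟩
      · rintro (⟨h3, h4⟩ | rfl)
        · exact ⟨by omega, by omega⟩
        · exact ⟨rfl, le_rfl⟩
    · rintro e ⟨h3, h4⟩ rfl
      exact (hedge (p - 2) (by omega)).2 ⟨by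
        have := hge (p - 2) (by omega); simp only [he₀] at h4; omega, by rw [hpp, hqp]⟩
  · intro ha hc k hak hkc
    have hpos := s3 (by rwa [hq0]) (by rwa [hqp])
    have hex : ∃ j, j + 1 < p ∧ q j ≤ k ∧ k ≤ q (j + 1) := by
      by_contra hcon
      push Not at hcon
      have hall : ∀ j < p, q j ≤ k := by
        intro j
        induction j with
        | zero => intro _; omega
        | succ j ihj =>
          intro hj
          exact (hcon j hj (ihj (by omega))).le
      have h1 := hall (p - 2) (by omega)
      have h2 := hcon (p - 2) (by omega) h1
      rw [show p - 2 + 1 = p - 1 by omega, hqp] at h2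
      omega
    obtain ⟨j, hj, h1, h2⟩ := hex
    exact (hIH j hj).2.2 (hpos j (by omega)) (hpos (j + 1) hj) k h1 h2

end PolygonDissection

/-! ### Weighted sums as values of a linear functional on polynomials -/

section WeightFunctional

open MvPolynomial

variable {σ : Type*}

/-- The linear functional on polynomials that maps a monomial `∏ X_e ^ m_e` to `∏ u e m_e`. -/
noncomputable def weightFunctional (u : σ → ℕ → ℝ) : MvPolynomial σ ℝ →ₗ[ℝ] ℝ :=
  (basisMonomials σ ℝ).constr ℝ fun m => m.prod u

lemma weightFunctional_monomial (u : σ → ℕ → ℝ) (m : σ →₀ ℕ) (c : ℝ) :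
    weightFunctional u (monomial m c) = c * m.prod u := by
  have h : weightFunctional u (monomial m 1) = m.prod u := by
    have := (basisMonomials σ ℝ).constr_basis ℝ (fun m => m.prod u) m
    rwa [coe_basisMonomials] at this
  rw [show monomial m c = c • monomial m (1 : ℝ) by simp [smul_monomial], map_smul, h, smul_eq_mul]

lemma weightFunctional_one (u : σ → ℕ → ℝ) : weightFunctional u 1 = 1 := by
  have := weightFunctional_monomial u 0 1
  simpa using this

lemma monomial_sum_single {ι : Type*} (s : Finset ι) (w : ι → σ) :
    ∏ k ∈ s, (X (w k) : MvPolynomial σ ℝ) =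
      monomial (∑ k ∈ s, Finsupp.single (w k) 1) 1 := by
  classical
  induction s using Finset.induction_on with
  | empty => simp
  | insert a s ha ih =>
    rw [Finset.prod_insert ha, Finset.sum_insert ha, ih, X, monomial_mul, one_mul]

lemma sum_single_apply {ι : Type*} [DecidableEq σ] (s : Finset ι) (w : ι → σ) (e : σ) :
    (∑ k ∈ s, Finsupp.single (w k) 1 : σ →₀ ℕ) e = (s.filter fun k => w k = e).card := by
  rw [Finsupp.finsetSum_apply, Finset.card_filter]
  exact Finset.sum_congr rfl fun k _ => by rw [Finsupp.single_apply]

/-- Renaming of the variables along an injective map. -/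
lemma weightFunctional_rename {τ : Type*} {π : σ → τ} (hπ : Function.Injective π)
    (u : τ → ℕ → ℝ) (f : MvPolynomial σ ℝ) :
    weightFunctional u (rename π f) = weightFunctional (fun e => u (π e)) f := by
  rw [f.as_sum, map_sum, map_sum, map_sum]
  refine Finset.sum_congr rfl fun m _ => ?_
  rw [rename_monomial, weightFunctional_monomial, weightFunctional_monomial]
  congr 1
  -- Injectivity keeps the exponents of different variables from merging.
  exact Finsupp.prod_mapDomain_index_inj hπ

variable [Fintype σ] {u : σ → ℕ → ℝ}

lemma weightFunctional_prod_X [DecidableEq σ] (hu : ∀ e, u e 0 = 1) {ι : Type*} (s : Finset ι)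
    (w : ι → σ) :
    weightFunctional u (∏ k ∈ s, X (w k)) = ∏ e, u e (s.filter fun k => w k = e).card := by
  rw [monomial_sum_single, weightFunctional_monomial, one_mul, Finsupp.prod_fintype _ _ hu]
  exact Finset.prod_congr rfl fun e _ => by rw [sum_single_apply]

lemma prod_add_single [DecidableEq σ] (hu : ∀ e, u e 0 = 1) (m : σ →₀ ℕ) (e : σ) (k : ℕ) :
    (m + Finsupp.single e k).prod u = u e (m e + k) * ∏ f ∈ Finset.univ.erase e, u f (m f) := by
  rw [Finsupp.prod_fintype _ _ hu, ← Finset.mul_prod_erase _ _ (Finset.mem_univ e)]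
  congr 1
  · simp
  · refine Finset.prod_congr rfl fun f hf => ?_
    rw [Finsupp.add_apply, Finsupp.single_apply, if_neg (Finset.ne_of_mem_erase hf).symm, add_zero]

/-- Multiplication with a variable that does not occur. -/
lemma weightFunctional_mul_X_of_notMem (hu : ∀ e, u e 0 = 1) {f : MvPolynomial σ ℝ} {e : σ}
    (he : e ∉ f.vars) : weightFunctional u (f * X e) = u e 1 * weightFunctional u f := by
  classical
  rw [f.as_sum, Finset.sum_mul, map_sum, map_sum, Finset.mul_sum]
  refine Finset.sum_congr rfl fun m hm => ?_
  have hme : m e = 0 := by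
    by_contra h
    exact he ((mem_vars_iff_mem_support e).2 ⟨m, hm, Finsupp.mem_support_iff.2 h⟩)
  rw [X, monomial_mul, weightFunctional_monomial, weightFunctional_monomial, mul_one,
    prod_add_single hu, hme]
  have := prod_add_single hu m e 0
  rw [Finsupp.single_zero, add_zero, hme] at this
  rw [this, hu]
  ring

/-- Multiplication with a variable of constant weight. -/
lemma weightFunctional_mul_X_of_const (hu : ∀ e, u e 0 = 1) (f : MvPolynomial σ ℝ) {e : σ}
    (he : ∀ k, u e k = 1) : weightFunctional u (f * X e) = weightFunctional u f := by
  classical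
  rw [f.as_sum, Finset.sum_mul, map_sum, map_sum]
  refine Finset.sum_congr rfl fun m hm => ?_
  rw [X, monomial_mul, weightFunctional_monomial, weightFunctional_monomial, mul_one,
    prod_add_single hu]
  have := prod_add_single hu m e 0
  rw [Finsupp.single_zero, add_zero] at this
  rw [this, he, he]

/-- Multiplication with the square of a variable whose weights satisfy a three-term recurrence. -/
lemma weightFunctional_mul_X_mul_X (hu : ∀ e, u e 0 = 1) (f : MvPolynomial σ ℝ) {e : σ} {t : ℝ}
    (he : ∀ k, u e (k + 2) = t * u e (k + 1) - u e k) :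
    weightFunctional u (f * X e * X e) =
      t * weightFunctional u (f * X e) - weightFunctional u f := by
  classical
  rw [f.as_sum, Finset.sum_mul, Finset.sum_mul, map_sum, map_sum, map_sum, Finset.mul_sum,
    ← Finset.sum_sub_distrib]
  refine Finset.sum_congr rfl fun m hm => ?_
  rw [X, monomial_mul, monomial_mul, weightFunctional_monomial, weightFunctional_monomial,
    weightFunctional_monomial, mul_one, mul_one, add_assoc, ← Finsupp.single_add,
    prod_add_single hu, prod_add_single hu]
  have := prod_add_single hu m e 0
  rw [Finsupp.single_zero, add_zero] at this
  rw [this, he, add_zero]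
  ring

end WeightFunctional

/-! ### Weighted choices of subgons in a dissected polygon -/

namespace PolygonDissection

open MvPolynomial

variable {N : ℤ} (G : PolygonDissection N)

/-- The subgons incident to the vertex `k`. -/
noncomputable def cellsAt (k : ℤ) : Finset G.Cell :=
  open Classical in Finset.univ.filter fun e => k ∈ e.verts

/-- The sum of the variables of the subgons incident to the vertex `k`. -/
noncomputable def vertexSum (k : ℤ) : MvPolynomial G.Cell ℝ := ∑ e ∈ G.cellsAt k, X e

/-- The subgons incident to `k` that have a vertex beyond `n` or have `k` as an inner vertex. -/
noncomputable def freeCellsAt (n k : ℤ) : Finset G.Cell :=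
  open Classical in
  (G.cellsAt k).filter fun e => n < e.1.2 ∨ (e.1.1 < k ∧ k < e.1.2)

/-- The sum of the variables of the subgons in `freeCellsAt n k`. -/
noncomputable def freeVertexSum (n k : ℤ) : MvPolynomial G.Cell ℝ := ∑ e ∈ G.freeCellsAt n k, X e

/-- The Chebyshev weights of the subgons that have a vertex beyond `n`. -/
noncomputable def bridgingWeight (n : ℤ) (e : G.Cell) (k : ℕ) : ℝ :=
  if n < e.1.2 then chebyshevValue k e.size else 1

variable {G}

lemma quiddity_eq_sum (k : ℤ) : G.quiddity k = ∑ e ∈ G.cellsAt k, chordRatio e.size := by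
  rw [quiddity, ratioSum, cellsAt]
  congr!

lemma mem_cellsAt {k : ℤ} {e : G.Cell} : e ∈ G.cellsAt k ↔ k ∈ e.verts := by
  simp [cellsAt]

lemma mem_freeCellsAt {n k : ℤ} {e : G.Cell} :
    e ∈ G.freeCellsAt n k ↔ k ∈ e.verts ∧ (n < e.1.2 ∨ (e.1.1 < k ∧ k < e.1.2)) := by
  simp [freeCellsAt, mem_cellsAt]

lemma truncatedWeight_zero (e : G.Cell) : truncatedWeight e.size 0 = 1 := by
  have := e.three_le_size
  rw [truncatedWeight, if_neg (by omega), chebyshevValue_zero]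

lemma bridgingWeight_zero (n : ℤ) (e : G.Cell) : G.bridgingWeight n e 0 = 1 := by
  rw [bridgingWeight, chebyshevValue_zero, ite_self]

lemma bridgingWeight_one {n : ℤ} {e : G.Cell} (he : n < e.1.2) :
    G.bridgingWeight n e 1 = chordRatio e.size := by
  rw [bridgingWeight, if_pos he, chebyshevValue_one]

lemma bridgingWeight_add_two {n : ℤ} {e : G.Cell} (he : n < e.1.2) (k : ℕ) :
    G.bridgingWeight n e (k + 2) =
      chordRatio e.size * G.bridgingWeight n e (k + 1) - G.bridgingWeight n e k := by
  simp only [bridgingWeight, if_pos he, chebyshevValue_add_two]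

lemma bridgingWeight_of_le {n : ℤ} {e : G.Cell} (he : e.1.2 ≤ n) (k : ℕ) :
    G.bridgingWeight n e k = 1 := if_neg (not_lt.2 he)

namespace Cell

/-- The inner vertices of a subgon. -/
noncomputable def inner (e : G.Cell) : Finset ℤ :=
  e.verts.filter fun k => e.1.1 < k ∧ k < e.1.2

lemma mem_inner {e : G.Cell} {k : ℤ} : k ∈ e.inner ↔ k ∈ e.verts ∧ e.1.1 < k ∧ k < e.1.2 := by
  simp [inner]

lemma card_inner (e : G.Cell) : e.inner.card + 2 = e.size := by
  have h1 : e.inner = (e.verts.erase e.1.1).erase e.1.2 := by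
    ext k
    rw [mem_inner, Finset.mem_erase, Finset.mem_erase]
    constructor
    · rintro ⟨h1, h2, h3⟩
      exact ⟨by omega, by omega, h1⟩
    · rintro ⟨h1, h2, h3⟩
      have := (mem_verts.1 h3).1
      exact ⟨h3, by omega, by omega⟩
  have := e.three_le_size
  rw [h1, Finset.card_erase_of_mem, Finset.card_erase_of_mem e.left_mem]
  · change _ = e.verts.card
    change 3 ≤ e.verts.card at this
    omega
  · exact Finset.mem_erase.2 ⟨e.lt.ne', e.right_mem⟩

end Cell

/-- The inner vertices of the subgons below an edge partition the vertices strictly below it. -/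
lemma card_Ioo_eq_sum {a c : ℤ} (hac : G.edge a c) :
    (Finset.Ioo a c).card =
      ∑ e ∈ Finset.univ.filter fun e : G.Cell => a ≤ e.1.1 ∧ e.1.2 ≤ c, e.inner.card := by
  rw [← Finset.card_biUnion]
  · congr 1
    ext k
    simp only [Finset.mem_Ioo, Finset.mem_biUnion, Finset.mem_filter, Finset.mem_univ, true_and,
      Cell.mem_inner]
    constructor
    · rintro ⟨h1, h2⟩
      obtain ⟨e, he1, he2, he3, he4, he5⟩ := exists_strict hac h1 h2
      exact ⟨e, ⟨he4, he5⟩, he1, he2, he3⟩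
    · rintro ⟨e, ⟨h1, h2⟩, -, h3, h4⟩
      omega
  · intro e _ f _ hne
    refine Finset.disjoint_left.2 ?_
    intro k hk hk'
    rw [Cell.mem_inner] at hk hk'
    exact hne (Cell.eq_of_strict hk.1 hk'.1 hk.2.1 hk.2.2 hk'.2.1 hk'.2.2)

lemma inner_card_of_choice {n : ℤ} {I : Finset ℤ} (hI : Finset.Ioo 0 n ⊆ I) {e : G.Cell}
    (he : e.1.2 ≤ n) :
    (Finset.univ.filter fun k : I => e.1.1 < k.1 ∧ k.1 < e.1.2).card =
      (Finset.Ioo e.1.1 e.1.2).card := by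
  have h0 := G.range e.2.1
  refine Finset.card_nbij (fun k => k.1) ?_ ?_ ?_
  · intro k hk
    simpa using hk
  · intro k _ l _ h
    exact Subtype.ext h
  · intro k hk
    have hk' : e.1.1 < k ∧ k < e.1.2 := by simpa using hk
    exact ⟨⟨k, hI (Finset.mem_Ioo.2 (by omega))⟩, by simpa using hk', rfl⟩

/-- If no subgon is chosen too often, a subgon without vertices beyond `n` is chosen only at its
inner vertices. -/
lemma strict_of_multiplicity_le {n : ℤ} {I : Finset ℤ} (hI : Finset.Ioo 0 n ⊆ I) (w : I → G.Cell)
    (hw : ∀ k, k.1 ∈ (w k).verts)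
    (hmult : ∀ e, (Finset.univ.filter fun k => w k = e).card + 2 ≤ e.size)
    (k : I) (hk : (w k).1.2 ≤ n) : (w k).1.1 < k.1 ∧ k.1 < (w k).1.2 := by
  set e := w k with he
  set T := Finset.univ.filter fun k : I => e.1.1 < k.1 ∧ k.1 < e.1.2 with hT
  set C := Finset.univ.filter fun f : G.Cell => e.1.1 ≤ f.1.1 ∧ f.1.2 ≤ e.1.2 with hC
  -- Every choice made strictly below the longest side of `e` is a subgon below that side. There are
  -- as many such choices as inner vertices of these subgons, and each subgon is chosen at most as
  -- often as it has inner vertices. So all bounds are equalities, and no choice of `e` is left for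
  -- its two end vertices.
  have h1 : T.card = ∑ f ∈ C, (T.filter fun k => w k = f).card := by
    refine Finset.card_eq_sum_card_fiberwise fun l hl => ?_
    have hl' : e.1.1 < l.1 ∧ l.1 < e.1.2 := by simpa [hT] using hl
    simpa [hC] using Cell.subset_of_mem e.2.1 (hw l) hl'.1 hl'.2
  have h2 : T.card = ∑ f ∈ C, f.inner.card :=
    (inner_card_of_choice hI hk).trans (card_Ioo_eq_sum e.2.1)
  have hsub : ∀ f, (T.filter fun k => w k = f) ⊆ Finset.univ.filter fun k => w k = f :=
    fun f => Finset.filter_subset_filter _ (Finset.subset_univ _)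
  have hle : ∀ f ∈ C, (T.filter fun k => w k = f).card ≤ f.inner.card := fun f _ => by
    have := Finset.card_le_card (hsub f)
    have := hmult f
    have := f.card_inner
    omega
  have heq := (Finset.sum_eq_sum_iff_of_le hle).1 (h1.symm.trans h2) e (by simp [hC])
  have hset := Finset.eq_of_subset_of_card_le (hsub e) (by
    have := hmult e
    have := e.card_inner
    omega)
  have hmem : k ∈ T.filter fun k => w k = e := by
    rw [hset]; simp [he]
  have := (Finset.mem_filter.1 hmem).1
  simpa [hT] using this

/-- A subgon with a vertex beyond `n` cannot be chosen at its last vertex, hence at most `size - 1`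
times, and at `size - 1` the Chebyshev value is zero anyway. Any other subgon is chosen exactly at
its `size - 2` inner vertices, which gives weight 1. -/
lemma truncated_prod_eq {n : ℤ} {I : Finset ℤ} (hI : Finset.Ioo 0 n ⊆ I)
    (hI' : I ⊆ Finset.Icc 0 n) (w : I → G.Cell) (hw : ∀ k, w k ∈ G.freeCellsAt n k.1) (e : G.Cell) :
    truncatedWeight e.size (Finset.univ.filter fun k => w k = e).card =
      G.bridgingWeight n e (Finset.univ.filter fun k => w k = e).card := by
  set F := Finset.univ.filter fun k => w k = e with hF
  have h3 := e.three_le_size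
  have hmapcard : (F.map (Function.Embedding.subtype _)).card = F.card := Finset.card_map _
  by_cases he : n < e.1.2
  · have hsub : F.map (Function.Embedding.subtype _) ⊆ e.verts.erase e.1.2 := by
      intro k hk
      obtain ⟨l, hl, rfl⟩ := Finset.mem_map.1 hk
      have hl' : w l = e := by simpa [hF] using hl
      have h1 := (mem_freeCellsAt.1 (hw l)).1
      have h2 := Finset.mem_Icc.1 (hI' l.2)
      rw [Finset.mem_erase]
      exact ⟨by simp only [Function.Embedding.subtype_apply]; omega, hl' ▸ h1⟩
    have hle := Finset.card_le_card hsub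
    rw [hmapcard, Finset.card_erase_of_mem e.right_mem] at hle
    change F.card ≤ e.size - 1 at hle
    rw [bridgingWeight, if_pos he, truncatedWeight]
    split_ifs with hlt
    · rw [show F.card = e.size - 1 by omega, chebyshevValue_sub_one (by omega)]
    · rfl
  · have h0 := G.range e.2.1
    have hset : F.map (Function.Embedding.subtype _) = e.inner := by
      ext k
      rw [Cell.mem_inner, Finset.mem_map]
      constructor
      · rintro ⟨l, hl, rfl⟩
        have hl' : w l = e := by simpa [hF] using hl
        obtain ⟨h1, h2⟩ := mem_freeCellsAt.1 (hw l)
        rw [hl'] at h1 h2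
        exact ⟨h1, h2.resolve_left he⟩
      · rintro ⟨h1, h2, h4⟩
        refine ⟨⟨k, hI (Finset.mem_Ioo.2 (by omega))⟩, ?_, rfl⟩
        obtain ⟨h5, h6⟩ := mem_freeCellsAt.1 (hw ⟨k, hI (Finset.mem_Ioo.2 (by omega))⟩)
        have h7 := Cell.subset_of_mem e.2.1 h5 h2 h4
        have h8 := h6.resolve_left (by omega)
        simpa [hF] using Cell.eq_of_strict h5 h1 h8.1 h8.2 h2 h4
    rw [hset] at hmapcard
    have := e.card_inner
    rw [bridgingWeight_of_le (not_lt.1 he), truncatedWeight, if_neg (by omega),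
      show F.card = e.size - 2 by omega, chebyshevValue_sub_two (by omega)]

/-- The truncated weights may be replaced by the weights of the subgons that have a vertex
beyond `n`. -/
theorem truncated_eq_bridging {n : ℤ} {I : Finset ℤ} (hI : Finset.Ioo 0 n ⊆ I)
    (hI' : I ⊆ Finset.Icc 0 n) :
    weightFunctional (fun e : G.Cell => truncatedWeight e.size) (∏ k ∈ I, G.vertexSum k) =
      weightFunctional (G.bridgingWeight n) (∏ k ∈ I, G.freeVertexSum n k) := by
  classical
  rw [← Finset.prod_coe_sort I, ← Finset.prod_coe_sort I]
  simp only [vertexSum, freeVertexSum]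
  rw [Finset.prod_univ_sum, Finset.prod_univ_sum, map_sum, map_sum]
  symm
  have hsub : Fintype.piFinset (fun k : I => G.freeCellsAt n k.1) ⊆
      Fintype.piFinset (fun k : I => G.cellsAt k.1) :=
    Fintype.piFinset_subset _ _ fun k => Finset.filter_subset _ _
  rw [← Finset.sum_subset hsub]
  · refine Finset.sum_congr rfl fun w hw => ?_
    rw [Fintype.mem_piFinset] at hw
    rw [weightFunctional_prod_X (bridgingWeight_zero n), weightFunctional_prod_X
      truncatedWeight_zero]
    exact Finset.prod_congr rfl fun e _ => by convert (truncated_prod_eq hI hI' w hw e).symm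
  -- A choice outside the smaller set exceeds the bound for some subgon, so one factor of its
  -- truncated weight is zero.
  · intro w hw hw'
    rw [Fintype.mem_piFinset] at hw hw'
    simp only [mem_cellsAt] at hw
    rw [weightFunctional_prod_X truncatedWeight_zero]
    by_contra hne
    refine hw' fun k => mem_freeCellsAt.2 ⟨hw k, ?_⟩
    rcases lt_or_ge n (w k).1.2 with h | h
    · exact Or.inl h
    refine Or.inr (strict_of_multiplicity_le hI w hw (fun e => ?_) k h)
    by_contra hlt
    refine hne (Finset.prod_eq_zero (Finset.mem_univ e) ?_)
    rw [truncatedWeight, if_pos]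
    convert not_le.1 hlt

/-! ### Visible vertices and the recurrence for the weighted sums -/

variable (G)

/-- A vertex is visible if it is not strictly below an edge that ends at most at `n`. -/
def Visible (n q : ℤ) : Prop := ∀ x y, G.edge x y → y ≤ n → ¬ (x < q ∧ q < y)

variable {G}

lemma visible_of_mem_bridging {n q : ℤ} {e : G.Cell} (he : n < e.1.2) (hq : q ∈ e.verts) :
    G.Visible n q := by
  rintro x y hxy hy ⟨h1, h2⟩
  have := Cell.subset_of_mem hxy hq h1 h2
  omega

lemma Visible.lt_of_strict {n q : ℤ} (hq : G.Visible n q) {e : G.Cell} (h1 : e.1.1 < q)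
    (h2 : q < e.1.2) : n < e.1.2 := by
  by_contra h
  exact hq _ _ e.2.1 (not_lt.1 h) ⟨h1, h2⟩

lemma Visible.mem_freeCellsAt_iff {n q : ℤ} (hq : G.Visible n q) {e : G.Cell} :
    e ∈ G.freeCellsAt n q ↔ q ∈ e.verts ∧ n < e.1.2 := by
  rw [mem_freeCellsAt]
  constructor
  · rintro ⟨h1, h2 | h2⟩
    · exact ⟨h1, h2⟩
    · exact ⟨h1, hq.lt_of_strict h2.1 h2.2⟩
  · rintro ⟨h1, h2⟩
    exact ⟨h1, Or.inl h2⟩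

/-- At a hidden vertex there is no freedom: the one admissible subgon has constant weight 1, so the
vertex can be dropped from the product. -/
lemma freeCellsAt_of_hidden {n k x y : ℤ} (hxy : G.edge x y) (hy : y ≤ n) (h1 : x < k)
    (h2 : k < y) : ∃ e : G.Cell, e.1.2 ≤ n ∧ G.freeCellsAt n k = {e} := by
  obtain ⟨e, he1, he2, he3, he4, he5⟩ := exists_strict hxy h1 h2
  refine ⟨e, by omega, ?_⟩
  ext f
  rw [mem_freeCellsAt, Finset.mem_singleton]
  constructor
  · rintro ⟨h3, h4⟩
    have h5 := Cell.subset_of_mem hxy h3 h1 h2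
    have h6 := h4.resolve_left (by omega)
    exact Cell.eq_of_strict h3 he1 h6.1 h6.2 he2 he3
  · rintro rfl
    exact ⟨he1, Or.inr ⟨he2, he3⟩⟩

/-- The vertices strictly below an edge do not contribute. -/
lemma bridging_prod_drop {n i r q : ℤ} (hrq : G.edge r q) (hq : q ≤ n) (hi : i ≤ r)
    (f : MvPolynomial G.Cell ℝ) :
    weightFunctional (G.bridgingWeight n) (f * ∏ k ∈ Finset.Ioo i q, G.freeVertexSum n k) =
      weightFunctional (G.bridgingWeight n)
        (f * ∏ k ∈ Finset.Ioo i (r + 1), G.freeVertexSum n k) := by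
  have h0 := G.range hrq
  have key : ∀ d : ℕ, r + 1 + d ≤ q →
      weightFunctional (G.bridgingWeight n)
        (f * ∏ k ∈ Finset.Ioo i (r + 1 + d), G.freeVertexSum n k) =
      weightFunctional (G.bridgingWeight n)
        (f * ∏ k ∈ Finset.Ioo i (r + 1), G.freeVertexSum n k) := by
    intro d
    induction d with
    | zero => intro _; simp
    | succ d ih =>
      intro hd
      push_cast at hd
      have hins : Finset.Ioo i (r + 1 + (d + 1 : ℕ)) =
          insert (r + 1 + (d : ℤ)) (Finset.Ioo i (r + 1 + d)) := by
        ext k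
        simp only [Finset.mem_Ioo, Finset.mem_insert]
        push_cast
        omega
      rw [hins, Finset.prod_insert (by simp), ← ih (by omega)]
      obtain ⟨e, he, hset⟩ := freeCellsAt_of_hidden (k := r + 1 + d) hrq hq (by omega) (by omega)
      have : G.freeVertexSum n (r + 1 + d) = X e := by
        rw [freeVertexSum, hset, Finset.sum_singleton]
      rw [this, mul_left_comm, mul_comm (X e),
        weightFunctional_mul_X_of_const (bridgingWeight_zero n) _ (bridgingWeight_of_le he)]
  have := key (q - (r + 1)).toNat (by omega)
  rwa [show r + 1 + ((q - (r + 1)).toNat : ℤ) = q by omega] at this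

lemma mem_freeCellsAt_of_mem_vars {n : ℤ} {I : Finset ℤ} {e : G.Cell}
    (he : e ∈ (∏ k ∈ I, G.freeVertexSum n k).vars) : ∃ k ∈ I, e ∈ G.freeCellsAt n k := by
  classical
  have h1 := vars_prod (s := I) (fun k => G.freeVertexSum n k) he
  obtain ⟨k, hk, hek⟩ := Finset.mem_biUnion.1 h1
  refine ⟨k, hk, ?_⟩
  have h2 := vars_sum_subset (G.freeCellsAt n k) (fun e => (X e : MvPolynomial G.Cell ℝ)) hek
  obtain ⟨f, hf, hef⟩ := Finset.mem_biUnion.1 h2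
  rw [vars_X, Finset.mem_singleton] at hef
  rwa [hef]

/-- `r` is the first vertex joined to `q` by an edge that ends at `q`. -/
def IsPrev (G : PolygonDissection N) (r q : ℤ) : Prop := G.edge r q ∧ ∀ x, G.edge x q → r ≤ x

lemma exists_isPrev {q : ℤ} (h1 : 1 ≤ q) (h2 : q ≤ N) : ∃ r, G.IsPrev r q := by
  classical
  set T := (Finset.Icc 0 q).filter fun x => G.edge x q with hT
  have hne : T.Nonempty := ⟨q - 1, by
    simp only [hT, Finset.mem_filter, Finset.mem_Icc]
    have := G.step (a := q - 1) (by omega) (by omega)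
    rw [sub_add_cancel] at this
    exact ⟨by omega, this⟩⟩
  refine ⟨T.min' hne, ?_, fun x hx => T.min'_le x ?_⟩
  · exact (Finset.mem_filter.1 (T.min'_mem hne)).2
  · have := G.range hx
    simp only [hT, Finset.mem_filter, Finset.mem_Icc]
    exact ⟨by omega, hx⟩

/-- An edge hiding `r` would have to end at `q`, by noncrossing and because `q` is visible; but then
it starts before the first vertex joined to `q`. -/
lemma IsPrev.visible {n r q : ℤ} (h : G.IsPrev r q) (hq : G.Visible n q) : G.Visible n r := by
  rintro x y hxy hy ⟨h1, h2⟩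
  have h3 := G.range h.1
  have h4 := G.noncrossing hxy h.1
  have h5 := hq x y hxy hy
  have : y = q := by omega
  subst this
  have := h.2 x hxy
  omega

/-- Above two visible vertices joined by an edge there is a subgon with a vertex beyond `n`. -/
lemma exists_bridging {n r q : ℤ} (hn : n < N) (hrq : G.edge r q) (hqn : q ≤ n)
    (hr : G.Visible n r) (hq : G.Visible n q) :
    ∃ e : G.Cell, n < e.1.2 ∧ r ∈ e.verts ∧ q ∈ e.verts := by
  have h0 := G.range hrq
  -- A shortest longest side that properly spans the edge belongs to the subgon directly above the
  -- edge. If it ended by `n`, it would hide `r` or `q`.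
  set T := Finset.univ.filter fun e : G.Cell => e.1.1 ≤ r ∧ q < e.1.2 ∨ e.1.1 < r ∧ q ≤ e.1.2
    with hT
  have hne : T.Nonempty := ⟨⟨(0, N), G.root, by simp only; omega⟩,
    Finset.mem_filter.2 ⟨Finset.mem_univ _, by simp only; omega⟩⟩
  obtain ⟨e, he, hmin⟩ := T.exists_min_image (fun e => e.1.2 - e.1.1) hne
  have he' : e.1.1 ≤ r ∧ q < e.1.2 ∨ e.1.1 < r ∧ q ≤ e.1.2 := by simpa [hT] using he
  have hmin' : ∀ x y, G.edge x y → (x ≤ r ∧ q < y ∨ x < r ∧ q ≤ y) →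
      e.1.2 - e.1.1 ≤ y - x := fun x y hxy h =>
    hmin ⟨(x, y), hxy, by simp only; omega⟩ (Finset.mem_filter.2 ⟨Finset.mem_univ _, h⟩)
  refine ⟨e, ?_, ?_, ?_⟩
  · by_contra hlt
    have h1 := hr _ _ e.2.1 (by omega)
    have h2 := hq _ _ e.2.1 (by omega)
    omega
  · refine Cell.mem_verts.2 ⟨by omega, fun x y hxy h1 h2 h3 h4 => ?_⟩
    have h5 := G.noncrossing hxy hrq
    have h6 := hmin' x y hxy (by omega)
    omega
  · refine Cell.mem_verts.2 ⟨by omega, fun x y hxy h1 h2 h3 h4 => ?_⟩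
    have h5 := G.noncrossing hrq hxy
    have h6 := hmin' x y hxy (by omega)
    omega

/-- Two subgons with a vertex beyond `n` have at most one common vertex up to `n`. -/
lemma bridging_eq {n x y : ℤ} {e f : G.Cell} (he : n < e.1.2) (hf : n < f.1.2) (hxy : x < y)
    (hy : y ≤ n) (hxe : x ∈ e.verts) (hye : y ∈ e.verts) (hxf : x ∈ f.verts) (hyf : y ∈ f.verts) :
    e = f := by
  have h1 := G.noncrossing e.2.1 f.2.1
  have h2 := G.noncrossing f.2.1 e.2.1
  rw [Cell.mem_verts] at hxe hye hxf hyf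
  by_cases h : e.1.1 ≤ f.1.1 ∧ f.1.2 ≤ e.1.2
  · have := hye.2 _ _ f.2.1 h.1 h.2 (by omega) (by omega)
    exact Cell.ext' this.1.symm this.2.symm
  · have := hyf.2 _ _ e.2.1 (by omega) (by omega) (by omega) (by omega)
    exact Cell.ext' this.1 this.2

/-- A subgon with a vertex beyond `n` that contains `q` and an earlier vertex contains the
predecessor of `q`. -/
lemma mem_prev_of_bridging {n k r q : ℤ} {e : G.Cell} (he : n < e.1.2) (h : G.IsPrev r q)
    (hqn : q ≤ n) (hkq : k < q) (hk : k ∈ e.verts) (hq : q ∈ e.verts) :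
    k ≤ r ∧ r ∈ e.verts := by
  have h0 := G.range h.1
  have hkr : k ≤ r := by
    by_contra hlt
    have := Cell.subset_of_mem h.1 hk (by omega) hkq
    omega
  refine ⟨hkr, ?_⟩
  have hr := h.visible (visible_of_mem_bridging he hq)
  rcases hkr.eq_or_lt with rfl | hlt
  · exact hk
  rw [Cell.mem_verts] at hk hq ⊢
  refine ⟨by omega, fun x y hxy h1 h2 h3 h4 => ?_⟩
  by_contra hne
  have h5 : ¬ (x < k ∧ k < y) := fun h' => hne (hk.2 x y hxy h1 h2 h'.1 h'.2)
  have h6 : ¬ (x < q ∧ q < y) := fun h' => hne (hq.2 x y hxy h1 h2 h'.1 h'.2)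
  exact hr x y hxy (by omega) ⟨h3, h4⟩

/-- An inner vertex of the lower boundary of a subgon with a vertex beyond `n` belongs to no other
such subgon. -/
lemma bridging_eq_of_between {n k r q : ℤ} {e f : G.Cell} (he : n < e.1.2) (hf : n < f.1.2)
    (hkr : k < r) (hrq : r < q) (hqn : q ≤ n) (hk : k ∈ e.verts) (hr : r ∈ e.verts)
    (hq : q ∈ e.verts) (hrf : r ∈ f.verts) : f = e := by
  have hrf' := Cell.mem_verts.1 hrf
  have hk' := Cell.mem_verts.1 hk
  have hq' := Cell.mem_verts.1 hq
  rcases hrf'.1.1.lt_or_eq with h1 | h1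
  · exact Cell.eq_of_strict hrf hr h1 (by omega) (by omega) (by omega)
  · have h2 := G.noncrossing e.2.1 f.2.1
    have := hq'.2 _ _ f.2.1 (by omega) (by omega) (by omega) (by omega)
    omega

variable (G)

/-- The sum over choices of subgons at the vertices strictly between `i` and `j`, weighted by the
subgons that have a vertex beyond `n`. -/
noncomputable def bridgingSum (n i j : ℤ) : ℝ :=
  if j ≤ i then 0 else
    weightFunctional (G.bridgingWeight n) (∏ k ∈ Finset.Ioo i j, G.freeVertexSum n k)

variable {G}

lemma Ioo_succ {i q : ℤ} (h : i < q) : Finset.Ioo i (q + 1) = insert q (Finset.Ioo i q) := by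
  ext k
  simp only [Finset.mem_Ioo, Finset.mem_insert]
  omega

lemma bridgingSum_eq_of_edge {n i r q : ℤ} (hrq : G.edge r q) (hq : q ≤ n) (hi : i ≤ r) :
    G.bridgingSum n i q = G.bridgingSum n i (r + 1) := by
  have h0 := G.range hrq
  rw [bridgingSum, bridgingSum, if_neg (by omega), if_neg (by omega)]
  simpa using bridging_prod_drop hrq hq hi 1

/-- Among the subgons available at `q`, only the subgon `e₀` directly above the edge from `r` to `q`
can have been chosen before. A fresh subgon contributes the factor `λ`; for `e₀` a repeated choice
is reduced by the three-term recurrence, which produces the subtracted term. -/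
lemma bridgingSum_succ {n i r q : ℤ} (hn : n < N) (hi : -1 ≤ i) (hi0 : i ≤ 0) (h : G.IsPrev r q)
    (hqn : q ≤ n) (hq : G.Visible n q) :
    G.bridgingSum n i (q + 1) =
      G.ratioSum (fun e => q ∈ e.verts ∧ n < e.1.2) * G.bridgingSum n i q -
        G.bridgingSum n i r := by
  classical
  have h0 := G.range h.1
  have hr := h.visible hq
  obtain ⟨e₀, he₀, hre₀, hqe₀⟩ := exists_bridging hn h.1 hqn hr hq
  set L := weightFunctional (G.bridgingWeight n) with hL
  set P := ∏ k ∈ Finset.Ioo i q, G.freeVertexSum n k with hP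
  have hu := G.bridgingWeight_zero n
  have hfree : G.freeCellsAt n q = Finset.univ.filter fun e : G.Cell => q ∈ e.verts ∧ n < e.1.2 := by
    ext e
    rw [hq.mem_freeCellsAt_iff]
    simp
  have key : ∀ e ∈ G.freeCellsAt n q, L (P * X e) =
      chordRatio e.size * L P - if e = e₀ then G.bridgingSum n i r else 0 := by
    intro e he
    obtain ⟨hqe, hen⟩ := hq.mem_freeCellsAt_iff.1 he
    have hvars : ∀ f : G.Cell, n < f.1.2 → ∀ j, f ∈ (∏ k ∈ Finset.Ioo i j, G.freeVertexSum n k).vars →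
        ∃ k, i < k ∧ k < j ∧ k ∈ f.verts := by
      intro f hf j hfv
      obtain ⟨k, hk, hfk⟩ := mem_freeCellsAt_of_mem_vars hfv
      rw [Finset.mem_Ioo] at hk
      exact ⟨k, hk.1, hk.2, (mem_freeCellsAt.1 hfk).1⟩
    by_cases hee : e = e₀
    · subst hee
      rw [if_pos rfl]
      -- Vertices of `e` before `q` are at most `r`, so here none of them is a position of the
      -- product and `e` is fresh. The default value 0 of `bridgingSum` removes the correction term.
      by_cases hir : r ≤ i
      · rw [hL, weightFunctional_mul_X_of_notMem hu, bridgingWeight_one hen, bridgingSum,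
          if_pos hir, sub_zero]
        intro hv
        obtain ⟨k, hk1, hk2, hk3⟩ := hvars e hen q hv
        have := (mem_prev_of_bridging hen h hqn hk2 hk3 hqe).1
        omega
      · set Q := ∏ k ∈ Finset.Ioo i r, G.freeVertexSum n k with hQ
        have hPQ : ∏ k ∈ Finset.Ioo i (r + 1), G.freeVertexSum n k =
            ∑ f ∈ G.freeCellsAt n r, Q * X f := by
          rw [Ioo_succ (by omega), Finset.prod_insert (by simp), ← hQ, freeVertexSum, mul_comm,
            Finset.mul_sum]
        have e1 : L (P * X e) = ∑ f ∈ G.freeCellsAt n r, L (Q * X f * X e) := by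
          rw [mul_comm, hL, hP, bridging_prod_drop h.1 hqn (by omega), hPQ, Finset.mul_sum,
            map_sum]
          exact Finset.sum_congr rfl fun f _ => by rw [mul_comm]
        have e2 : L P = ∑ f ∈ G.freeCellsAt n r, L (Q * X f) := by
          have := bridging_prod_drop h.1 hqn (show i ≤ r by omega) 1
          rw [one_mul, one_mul, hPQ, map_sum] at this
          exact this
        have he_r : e ∈ G.freeCellsAt n r := hr.mem_freeCellsAt_iff.2 ⟨hre₀, hen⟩
        have e3 : ∑ f ∈ G.freeCellsAt n r, (if f = e then L Q else 0) = L Q := by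
          rw [Finset.sum_ite_eq' , if_pos he_r]
        rw [e1, e2, bridgingSum, if_neg hir, ← hL, ← hQ, ← e3, Finset.mul_sum,
          ← Finset.sum_sub_distrib]
        refine Finset.sum_congr rfl fun f hf => ?_
        obtain ⟨hrf, hfn⟩ := hr.mem_freeCellsAt_iff.1 hf
        split_ifs with hfe
        · subst hfe
          exact weightFunctional_mul_X_mul_X hu Q (bridgingWeight_add_two hfn)
        -- Had `e` been available before `r`, then `r` would lie between two of its vertices and `e`
        -- would be the only option at `r`, against `f ≠ e`.
        · rw [hL, weightFunctional_mul_X_of_notMem hu, bridgingWeight_one hen, sub_zero]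
          intro hv
          rcases Finset.mem_union.1 (vars_mul _ _ hv) with hv | hv
          · obtain ⟨k, hk1, hk2, hk3⟩ := hvars e hen r hv
            exact hfe (bridging_eq_of_between hen hfn hk2 h0.2.1 hqn hk3 hre₀ hqe hrf)
          · rw [vars_X, Finset.mem_singleton] at hv
            exact hfe hv.symm
    -- An earlier vertex of `e` would put `r` into `e`, and two such subgons sharing `r` and `q`
    -- coincide.
    · rw [if_neg hee, sub_zero, hL, weightFunctional_mul_X_of_notMem hu, bridgingWeight_one hen]
      intro hv
      obtain ⟨k, hk1, hk2, hk3⟩ := hvars e hen q hv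
      have h4 := (mem_prev_of_bridging hen h hqn hk2 hk3 hqe).2
      exact hee (bridging_eq hen he₀ h0.2.1 hqn h4 hqe hre₀ hqe₀)
  by_cases hiq : q ≤ i
  · omega
  rw [bridgingSum, if_neg (by omega), bridgingSum.eq_def G n i q, if_neg hiq, ← hL, ← hP,
    Ioo_succ (by omega), Finset.prod_insert (by simp), ← hP, freeVertexSum, mul_comm,
    Finset.mul_sum, map_sum, Finset.sum_congr rfl key, Finset.sum_sub_distrib, ← Finset.sum_mul,
    Finset.sum_ite_eq', if_pos (hq.mem_freeCellsAt_iff.2 ⟨hqe₀, he₀⟩), ratioSum, hfree]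
  congr!

/-- The quiddity at a visible vertex. -/
lemma quiddity_of_visible {n q : ℤ} (hq : G.Visible n q) :
    G.quiddity q = G.ratioSum (fun e => q ∈ e.verts ∧ n < e.1.2) +
      (G.ratioSum (fun e => e.1.1 = q ∧ e.1.2 ≤ n) +
        G.ratioSum (fun e => e.1.2 = q ∧ e.1.2 ≤ n)) := by
  rw [← ratioSum_or (p := fun e => (e.1.1 = q ∧ e.1.2 ≤ n) ∨ e.1.2 = q ∧ e.1.2 ≤ n)
    (fun e => Iff.rfl)]
  · refine ratioSum_or (fun e => ?_) (fun e h => by omega)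
    constructor
    · intro he
      have h1 := (Cell.mem_verts.1 he).1
      by_cases h2 : n < e.1.2
      · exact Or.inl ⟨he, h2⟩
      · have := fun h => hq.lt_of_strict (e := e) h
        right
        omega
    · rintro (⟨h, -⟩ | ⟨h, -⟩ | ⟨h, -⟩)
      · exact h
      · rw [← h]; exact e.left_mem
      · rw [← h]; exact e.right_mem
  · intro e h1 h2
    have := e.lt
    omega

/-- The sum of weighted choices solves the recurrence given by the quiddity cycle. -/
theorem bridgingSum_eq_solution {n i : ℤ} (hn : n < N) (hi : -1 ≤ i) (hi0 : i ≤ 0) {g : ℤ → ℝ}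
    (hgi : g i = 0) (hgi' : g (i + 1) = 1)
    (hg : ∀ k, i < k → k < n → g (k - 1) + g (k + 1) = G.quiddity k * g k) {j : ℤ} (hj0 : 0 ≤ j)
    (hjn : j ≤ n) (hj : G.Visible n j) : G.bridgingSum n i j = g j := by
  obtain ⟨d, hd⟩ : ∃ d, j.toNat = d := ⟨_, rfl⟩
  induction d using Nat.strong_induction_on generalizing j with
  | _ d ih =>
  have hvis0 : ∀ q, q = 0 → G.Visible n q := by
    rintro q rfl x y hxy _ ⟨h1, -⟩
    have := G.range hxy
    omega
  rcases hj0.eq_or_lt with rfl | hj1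
  · rcases hi0.eq_or_lt with rfl | hi1
    · rw [bridgingSum, if_pos le_rfl, hgi]
    · obtain rfl : i = -1 := by omega
      rw [bridgingSum, if_neg (by omega)]
      have : Finset.Ioo (-1 : ℤ) 0 = ∅ := by decide
      rw [this, Finset.prod_empty, weightFunctional_one]
      simpa using hgi'.symm
  obtain ⟨q, hqj⟩ := exists_isPrev (G := G) (q := j) (by omega) (by omega)
  have hq := hqj.visible hj
  have h0 := G.range hqj.1
  -- Contract the edge from `q` to `j`: the weighted sum loses the vertices hidden below it, and `g
  -- j` is expressed by `g q` and `g (q + 1)`.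
  have hstep := (solution_below_edge hqj.1 (fun k h1 h2 => hg k (by omega) (by omega))).1
  have hα : G.ratioSum (fun e => e.1.1 = q ∧ e.1.2 ≤ j) =
      G.ratioSum (fun e => e.1.1 = q ∧ e.1.2 ≤ n) := by
    refine ratioSum_congr fun e => ?_
    have := fun h => hj.lt_of_strict (e := e) h
    omega
  rw [hα] at hstep
  rw [bridgingSum_eq_of_edge hqj.1 hjn (by omega), ← hstep]
  rcases h0.1.eq_or_lt with rfl | hq1
  · have hγ : G.ratioSum (fun e => e.1.2 = 0 ∧ e.1.2 ≤ n) = 0 :=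
      ratioSum_eq_zero fun e h => by have := G.range e.2.1; omega
    rcases hi0.eq_or_lt with rfl | hi1
    · rw [bridgingSum, if_neg (by omega)]
      have : Finset.Ioo (0 : ℤ) (0 + 1) = ∅ := by decide
      rw [this, Finset.prod_empty, weightFunctional_one, hgi, hgi']
      ring
    -- The vertex `0` has no predecessor; the recurrence at `0` with the artificial value `g (-1) =
    -- 0` takes its place.
    · obtain rfl : i = -1 := by omega
      have hg0 : g 0 = 1 := by simpa using hgi'
      have hrec := hg 0 (by omega) (by omega)
      rw [quiddity_of_visible hq, hγ, hg0, show (0 : ℤ) - 1 = -1 by norm_num, hgi] at hrec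
      rw [bridgingSum, if_neg (by omega)]
      have : Finset.Ioo (-1 : ℤ) (0 + 1) = {0} := by decide
      rw [this, Finset.prod_singleton, freeVertexSum, map_sum, hg0]
      have hsum : ∑ e ∈ G.freeCellsAt n 0, weightFunctional (G.bridgingWeight n) (X e) =
          G.ratioSum (fun e => 0 ∈ e.verts ∧ n < e.1.2) := by
        rw [ratioSum]
        refine Finset.sum_congr ?_ fun e he => ?_
        · ext e
          rw [hq.mem_freeCellsAt_iff]
          simp
        · have h1 := (hq.mem_freeCellsAt_iff.1
            (by rw [hq.mem_freeCellsAt_iff]; simpa using he : e ∈ G.freeCellsAt n 0)).2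
          have h2 := weightFunctional_mul_X_of_notMem (f := 1) (e := e)
            (G.bridgingWeight_zero n) (by simp)
          rwa [one_mul, weightFunctional_one, mul_one, bridgingWeight_one h1] at h2
      rw [hsum]
      linarith
  · obtain ⟨r, hrq⟩ := exists_isPrev (G := G) (q := q) (by omega) (by omega)
    have h1 := G.range hrq.1
    have hr := hrq.visible hq
    -- Contract the edge from `r` to `q` as well. The recurrence at `q` then keeps only the part of
    -- the quiddity coming from subgons with a vertex beyond `n`, as in `bridgingSum_succ`.
    have hstep2 := (solution_below_edge hrq.1 (fun k h1 h2 => hg k (by omega) (by omega))).2.1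
    have hγ : G.ratioSum (fun e => e.1.2 = q ∧ r ≤ e.1.1) =
        G.ratioSum (fun e => e.1.2 = q ∧ e.1.2 ≤ n) := by
      refine ratioSum_congr fun e => ?_
      constructor
      · rintro ⟨h2, -⟩
        omega
      · rintro ⟨h2, -⟩
        exact ⟨h2, hrq.2 _ (h2 ▸ e.2.1)⟩
    rw [hγ] at hstep2
    have hrec := hg q (by omega) (by omega)
    rw [quiddity_of_visible hq] at hrec
    rw [bridgingSum_succ hn hi hi0 hrq (by omega) hq,
      ih q.toNat (by omega) (by omega) (by omega) hq rfl,
      ih r.toNat (by omega) (by omega) (by omega) hr rfl]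
    linear_combination -hrec + hstep2

lemma visible_self (n : ℤ) : G.Visible n n := fun x y _ h => by omega

/-- Starting at `i = -1` includes the vertex `0` among the positions and leaves out `n`. -/
theorem weightFunctional_prod_left {n : ℤ} (hn1 : 1 ≤ n) (hn : n < N) {g : ℤ → ℝ}
    (hg0 : g (-1) = 0) (hg1 : g 0 = 1)
    (hg : ∀ k, -1 < k → k < n → g (k - 1) + g (k + 1) = G.quiddity k * g k) :
    weightFunctional (fun e : G.Cell => truncatedWeight e.size)
      (∏ k ∈ Finset.Ico 0 n, G.vertexSum k) = g n := by
  rw [truncated_eq_bridging (n := n), ← bridgingSum_eq_solution hn (i := -1) le_rfl (by norm_num)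
    hg0 (by simpa using hg1) hg (by omega) le_rfl (visible_self n), bridgingSum, if_neg (by omega)]
  · congr 2
    ext k
    simp only [Finset.mem_Ioo, Finset.mem_Ico]
    omega
  · intro k
    simp only [Finset.mem_Ioo, Finset.mem_Ico]
    omega
  · intro k
    simp only [Finset.mem_Icc, Finset.mem_Ico]
    omega

/-- `bridgingSum_eq_solution` reaches only up to `n`. The position `n` is added by one more step of
`bridgingSum_succ`, matched by the recurrence at `n` with the quiddity of the polygon there. -/
theorem weightFunctional_prod_right {n : ℤ} (hn1 : 1 ≤ n) (hn : n < N) {g : ℤ → ℝ}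
    (hg0 : g 0 = 0) (hg1 : g 1 = 1)
    (hg : ∀ k, 0 < k → k ≤ n → g (k - 1) + g (k + 1) = G.quiddity k * g k) :
    weightFunctional (fun e : G.Cell => truncatedWeight e.size)
      (∏ k ∈ Finset.Ioo 0 (n + 1), G.vertexSum k) = g (n + 1) := by
  obtain ⟨r, hrq⟩ := exists_isPrev (G := G) (q := n) (by omega) (by omega)
  have h1 := G.range hrq.1
  have hg' : ∀ k, 0 < k → k < n → g (k - 1) + g (k + 1) = G.quiddity k * g k :=
    fun k h1 h2 => hg k h1 h2.le
  have e1 := bridgingSum_eq_solution hn (by norm_num) le_rfl hg0 (by simpa using hg1) hg'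
    (by omega) le_rfl (visible_self n)
  have e2 := bridgingSum_eq_solution hn (by norm_num) le_rfl hg0 (by simpa using hg1) hg'
    (by omega) (by omega) (hrq.visible (visible_self n))
  have e3 := bridgingSum_succ hn (i := 0) (by norm_num) le_rfl hrq le_rfl (visible_self n)
  have hstep := (solution_below_edge hrq.1 (fun k h1 h2 => hg k (by omega) (by omega))).2.1
  have hγ : G.ratioSum (fun e => e.1.2 = n ∧ r ≤ e.1.1) =
      G.ratioSum (fun e => e.1.2 = n ∧ e.1.2 ≤ n) := by
    refine ratioSum_congr fun e => ?_
    constructor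
    · rintro ⟨h2, -⟩
      omega
    · rintro ⟨h2, -⟩
      exact ⟨h2, hrq.2 _ (h2 ▸ e.2.1)⟩
  have hα : G.ratioSum (fun e => e.1.1 = n ∧ e.1.2 ≤ n) = 0 :=
    ratioSum_eq_zero fun e h => by have := e.lt; omega
  rw [hγ] at hstep
  have hrec := hg n (by omega) le_rfl
  rw [quiddity_of_visible (visible_self n), hα] at hrec
  rw [truncated_eq_bridging (n := n)]
  · rw [e1, e2, bridgingSum, if_neg (by omega)] at e3
    rw [e3]
    linear_combination -hrec + hstep
  · intro k
    simp only [Finset.mem_Ioo]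
    omega
  · intro k
    simp only [Finset.mem_Icc, Finset.mem_Ioo]
    omega

end PolygonDissection

/-! ### Continuants and frieze patterns -/

/-- The solution of `x (t + 2) = a (i + t + 1) * x (t + 1) - x t` with `x 0 = u`, `x 1 = v`. -/
noncomputable def recurrenceSolution (a : ℤ → ℝ) (i : ℤ) (u v : ℝ) : ℕ → ℝ
  | 0 => u
  | 1 => v
  | t + 2 => a (i + t + 1) * recurrenceSolution a i u v (t + 1) - recurrenceSolution a i u v t

/-- The continuant of the entries `a (i + 1), …, a (i + t - 1)`. -/
noncomputable def continuant (a : ℤ → ℝ) (i : ℤ) : ℕ → ℝ := recurrenceSolution a i 0 1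

section Continuant

variable (a : ℤ → ℝ)

lemma continuant_zero (i : ℤ) : continuant a i 0 = 0 := rfl

lemma continuant_one (i : ℤ) : continuant a i 1 = 1 := rfl

lemma continuant_add_two (i : ℤ) (t : ℕ) :
    continuant a i (t + 2) = a (i + t + 1) * continuant a i (t + 1) - continuant a i t := rfl

lemma continuant_add_two_left (i : ℤ) (t : ℕ) :
    continuant a i (t + 2) =
      a (i + 1) * continuant a (i + 1) (t + 1) - continuant a (i + 2) t := by
  induction t using Nat.twoStepInduction with
  | zero => simp [continuant_add_two, continuant_zero, continuant_one]
  | one =>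
    rw [continuant_add_two, continuant_add_two a i 0, continuant_add_two a (i + 1) 0]
    simp only [continuant_zero, continuant_one, zero_add]
    push_cast
    ring_nf
  | more t h1 h2 =>
    rw [continuant_add_two a i (t + 2), h2, h1, continuant_add_two a (i + 1) (t + 1),
      continuant_add_two a (i + 2) t]
    push_cast
    rw [show i + ((t : ℤ) + 2) + 1 = i + t + 3 by ring,
      show i + 1 + ((t : ℤ) + 1) + 1 = i + t + 3 by ring,
      show i + 2 + (t : ℤ) + 1 = i + t + 3 by ring]
    ring

lemma continuant_diamond (i : ℤ) (t : ℕ) :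
    continuant a (i - 1) (t + 1) * continuant a i (t + 1) -
      continuant a i t * continuant a (i - 1) (t + 2) = 1 := by
  induction t with
  | zero => simp [continuant_zero, continuant_one]
  | succ t ih =>
    rw [continuant_add_two a i t, continuant_add_two a (i - 1) (t + 1)]
    push_cast
    rw [show i - 1 + ((t : ℤ) + 1) + 1 = i + t + 1 by ring]
    rw [show t + 1 + 1 = t + 2 from rfl]
    linear_combination ih

variable {a}

/-- Continuants satisfy the same diamond rule, and this rule determines each further row from the
two preceding ones by division. Without the nonvanishing hypothesis the quiddity row need not
determine the pattern. -/
lemma frieze_eq_continuant {m : ℤ → ℤ → ℝ} (hm : IsInfiniteFrieze m)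
    (ha : ∀ i, m (i - 1) (i + 1) = a i) (hpos : ∀ i t, 0 < t → continuant a i t ≠ 0) (t : ℕ) :
    ∀ i, m i (i + t) = continuant a i t := by
  induction t using Nat.strong_induction_on with
  | _ t ih =>
    intro i
    match t, ih with
    | 0, _ => simpa [continuant_zero] using hm.row_zero i
    | 1, _ => simpa [continuant_one] using hm.row_one i
    | 2, _ =>
      have := ha (i + 1)
      rw [continuant_add_two, continuant_zero, zero_add, continuant_one]
      rw [show i + 1 - 1 = i by ring, show i + 1 + 1 = i + 2 by ring] at this
      push_cast
      rw [this]
      simp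
    | t + 3, ih =>
      have h1 := hm.diamond (i + 1) (i + 1 + (t + 1 : ℕ)) (by omega)
      have h2 := continuant_diamond a (i + 1) (t + 1)
      rw [show i + 1 - 1 = i by ring] at h1 h2
      rw [ih (t + 1) (by omega) (i + 1),
        show i + 1 + ((t + 1 : ℕ) : ℤ) + 1 = i + 1 + ((t + 2 : ℕ) : ℤ) by push_cast; ring,
        ih (t + 2) (by omega) (i + 1),
        show i + 1 + ((t + 1 : ℕ) : ℤ) = i + ((t + 2 : ℕ) : ℤ) by push_cast; ring,
        ih (t + 2) (by omega) i,
        show i + 1 + ((t + 2 : ℕ) : ℤ) = i + ((t + 3 : ℕ) : ℤ) by push_cast; ring] at h1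
      refine mul_left_cancel₀ (hpos (i + 1) (t + 1) (by omega)) ?_
      rw [show t + 1 + 1 = t + 2 from rfl, show t + 1 + 2 = t + 3 from rfl] at h2
      linear_combination h2 - h1

/-- Continuants are positive where the recurrence has a positive solution. -/
lemma continuant_pos {f : ℤ → ℝ} {i : ℤ} {t : ℕ} (ht : 0 < t)
    (hf : ∀ k, i ≤ k → k ≤ i + t → 0 < f k)
    (hrec : ∀ k, i < k → k < i + t → f (k - 1) + f (k + 1) = a k * f k) :
    0 < continuant a i t := by
  -- The discrete Wronskian of `f` and the continuant is constant, with value `f i`.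
  have key : ∀ s : ℕ, s + 1 ≤ t → f (i + s) * continuant a i (s + 1) =
      f i + f (i + s + 1) * continuant a i s := by
    intro s
    induction s with
    | zero => intro _; simp [continuant_zero, continuant_one]
    | succ s ih =>
      intro hs
      have h1 := ih (by omega)
      have h2 := hrec (i + s + 1) (by omega) (by omega)
      rw [continuant_add_two]
      push_cast
      rw [show i + (s : ℤ) + 1 - 1 = i + s by ring] at h2
      rw [← add_assoc]
      linear_combination h1 - continuant a i (s + 1) * h2
  have hpos : ∀ s : ℕ, s + 1 ≤ t → 0 < continuant a i (s + 1) := by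
    intro s
    induction s with
    | zero => intro _; simp [continuant_one]
    | succ s ih =>
      intro hs
      have h1 := key (s + 1) hs
      have h2 := ih (by omega)
      have h3 := hf i le_rfl (by omega)
      have h4 := hf (i + (s + 1 : ℕ) + 1) (by omega) (by omega)
      have h5 := hf (i + (s + 1 : ℕ)) (by omega) (by omega)
      exact pos_of_mul_pos_right (a := f (i + (s + 1 : ℕ))) (h1 ▸ by positivity) h5.le
  obtain ⟨s, rfl⟩ : ∃ s, t = s + 1 := ⟨t - 1, by omega⟩
  exact hpos s le_rfl

/-- The growth coefficient of an `n`-periodic frieze pattern may be computed anywhere. -/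
lemma growth_shift {n : ℕ} (hn : 1 ≤ n) (hper : ∀ k, a (k + n) = a k) (i j : ℤ) :
    continuant a i (n + 1) - continuant a (i + 1) (n - 1) =
      continuant a j (n + 1) - continuant a (j + 1) (n - 1) := by
  obtain ⟨s, rfl⟩ : ∃ s, n = s + 1 := ⟨n - 1, by omega⟩
  -- Expand one continuant at its left end and the other at its right end: the middle continuant is
  -- the same, and the coefficients `a (i + 1)` and `a (i + 1 + n)` agree.
  have step : ∀ i : ℤ, continuant a i (s + 1 + 1) - continuant a (i + 1) (s + 1 - 1) =
      continuant a (i + 1) (s + 1 + 1) - continuant a (i + 1 + 1) (s + 1 - 1) := by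
    intro i
    have h1 := continuant_add_two_left a i s
    have h2 := continuant_add_two a (i + 1) s
    have h3 := hper (i + 1)
    push_cast at h3
    rw [show i + 1 + ((s : ℤ) + 1) = i + 1 + s + 1 by ring] at h3
    rw [h3] at h2
    rw [show s + 1 + 1 = s + 2 from rfl, h1, h2, show i + 1 + 1 = i + 2 by ring]
    simp only [Nat.add_sub_cancel]
    ring
  have key : ∀ i : ℤ, continuant a i (s + 1 + 1) - continuant a (i + 1) (s + 1 - 1) =
      continuant a 0 (s + 1 + 1) - continuant a (0 + 1) (s + 1 - 1) := by
    intro i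
    induction i using Int.induction_on with
    | zero => rfl
    | succ i ih => rw [← step]; exact ih
    | pred i ih => rw [step, sub_add_cancel]; exact ih
  rw [key i, key j]

end Continuant

/-! ### Positivity and the growth coefficient on a dissected polygon -/

namespace PolygonDissection

variable {N : ℤ} {G : PolygonDissection N}

/-- The recurrence given by the quiddity cycle of a dissected polygon has a positive solution. -/
lemma exists_pos_solution (G : PolygonDissection N) : ∃ f : ℤ → ℝ,
    (∀ k, 0 ≤ k → k ≤ N → 0 < f k) ∧
      ∀ k, 0 < k → k < N → f (k - 1) + f (k + 1) = G.quiddity k * f k := by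
  set α := G.ratioSum (fun e => e.1.1 = 0 ∧ e.1.2 ≤ N)
  -- The second value `1 + α` is chosen so that `solution_below_edge` for the root gives 1 at `N`.
  -- Positivity at both ends of the root then spreads to all vertices.
  set h := recurrenceSolution G.quiddity 0 1 (1 + α) with hh
  have hrec : ∀ k, 0 < k → k < N →
      h (k - 1).toNat + h (k + 1).toNat = G.quiddity k * h k.toNat := by
    intro k hk _
    obtain ⟨t, rfl⟩ : ∃ t : ℕ, k = t + 1 := ⟨(k - 1).toNat, by omega⟩
    rw [show ((t : ℤ) + 1 - 1).toNat = t by omega, show ((t : ℤ) + 1 + 1).toNat = t + 2 by omega,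
      show ((t : ℤ) + 1).toNat = t + 1 by omega, hh, recurrenceSolution]
    rw [zero_add]
    ring
  have hsol := solution_below_edge (g := fun k => h k.toNat) G.root hrec
  refine ⟨fun k => h k.toNat, hsol.2.2 (by simp [hh, recurrenceSolution]) ?_, hrec⟩
  rw [← hsol.1]
  simp [hh, recurrenceSolution, α]

/-- The positive solution on the polygon serves as comparison solution on the stretch `0, …, M`,
where `a` agrees with the quiddity cycle at the inner positions. -/
lemma continuant_pos_of_quiddity {a : ℤ → ℝ} {k₀ M : ℤ} (hM : M ≤ N)
    (ha : ∀ k, 0 < k → k < M → a (k₀ + k) = G.quiddity k) {i : ℤ} {t : ℕ} (ht : 0 < t)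
    (hi : k₀ ≤ i) (hit : i + t ≤ k₀ + M) : 0 < continuant a i t := by
  obtain ⟨f, hf, hrec⟩ := G.exists_pos_solution
  refine continuant_pos (f := fun k => f (k - k₀)) ht (fun k h1 h2 => hf _ (by omega) (by omega))
    fun k h1 h2 => ?_
  have e1 := hrec (k - k₀) (by omega) (by omega)
  have e2 := ha (k - k₀) (by omega) (by omega)
  rw [add_sub_cancel] at e2
  rw [e2, ← e1]
  congr 2 <;> ring

/-- The two sums over weighted choices add up to the growth coefficient. -/
theorem weightFunctional_add_eq_growth {a : ℤ → ℝ} {k₀ : ℤ} {n : ℕ} (hn1 : 1 ≤ n) (hn : (n : ℤ) < N)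
    (ha : ∀ k : ℤ, 0 < k → k < n → a (k₀ + k) = G.quiddity k)
    (ha0 : a (k₀ + n) = G.quiddity 0 + G.quiddity n) :
    weightFunctional (fun e : G.Cell => truncatedWeight e.size)
        (∏ k ∈ Finset.Ico 0 (n : ℤ), G.vertexSum k) +
      weightFunctional (fun e : G.Cell => truncatedWeight e.size)
        (∏ k ∈ Finset.Ioo 0 ((n : ℤ) + 1), G.vertexSum k) =
      continuant a k₀ (n + 1) - continuant a (k₀ + 1) (n - 1) := by
  obtain ⟨s, rfl⟩ : ∃ s, n = s + 1 := ⟨n - 1, by omega⟩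
  -- Each solution sees only the share of the entry `a (k₀ + n)` belonging to its copy of the cut
  -- vertex. The first is a continuant expanded at its left end with `G.quiddity 0` as the entry
  -- there, the second one expanded at its right end with `G.quiddity n`. Adding them restores the
  -- full entry.
  rw [weightFunctional_prod_left (by omega) hn
    (g := fun k => if k = -1 then 0 else if k = 0 then 1 else
      G.quiddity 0 * continuant a k₀ k.toNat - continuant a (k₀ + 1) (k - 1).toNat)
    (by simp) (by simp),
    weightFunctional_prod_right (by omega) hn
    (g := fun k => if k = (s + 1 : ℕ) + 1 then
      G.quiddity (s + 1 : ℕ) * continuant a k₀ (s + 1) - continuant a k₀ s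
      else continuant a k₀ k.toNat)]
  · have h1 := continuant_add_two a k₀ s
    have e1 : ((s + 1 : ℕ) : ℤ) ≠ -1 := by omega
    have e2 : ((s + 1 : ℕ) : ℤ) ≠ 0 := by omega
    have e3 : (((s + 1 : ℕ) : ℤ) - 1).toNat = s := by omega
    have e4 : k₀ + (s : ℤ) + 1 = k₀ + ((s + 1 : ℕ) : ℤ) := by push_cast; ring
    simp only [if_true, if_neg e1, if_neg e2, Int.toNat_natCast, e3, Nat.add_sub_cancel]
    rw [show s + 1 + 1 = s + 2 from rfl, h1, e4, ha0]
    ring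
  · rw [if_neg (by omega)]; rfl
  · rw [if_neg (by omega)]; rfl
  · intro k hk1 hk2
    obtain ⟨t, rfl⟩ : ∃ t : ℕ, k = t + 1 := ⟨(k - 1).toNat, by omega⟩
    simp only [show ((t : ℤ) + 1 - 1) = t by ring, Int.toNat_natCast,
      show ((t : ℤ) + 1 + 1).toNat = t + 2 by omega, show ((t : ℤ) + 1).toNat = t + 1 by omega,
      if_neg (show ¬ ((t : ℤ) = (s + 1 : ℕ) + 1) by omega),
      if_neg (show ¬ ((t : ℤ) + 1 = (s + 1 : ℕ) + 1) by omega)]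
    by_cases hts : t = s
    · subst hts
      rw [if_pos (by push_cast; ring)]
      push_cast
      ring
    · rw [if_neg (by omega), ← ha _ hk1 (by omega), continuant_add_two, ← add_assoc]
      ring
  · intro k hk1 hk2
    rcases (show 0 ≤ k by omega).eq_or_lt with rfl | hk0
    · simp [continuant_zero, continuant_one]
    obtain ⟨t, rfl⟩ : ∃ t : ℕ, k = t + 1 := ⟨(k - 1).toNat, by omega⟩
    rw [← ha _ hk0 hk2]
    cases t with
    | zero =>
      simp [continuant_zero, continuant_one, continuant_add_two]
      ring
    | succ t =>
      simp only [if_neg (show ¬ (((t + 1 : ℕ) : ℤ) + 1 - 1 = -1) by omega),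
        if_neg (show ¬ (((t + 1 : ℕ) : ℤ) + 1 - 1 = 0) by omega),
        if_neg (show ¬ (((t + 1 : ℕ) : ℤ) + 1 + 1 = -1) by omega),
        if_neg (show ¬ (((t + 1 : ℕ) : ℤ) + 1 + 1 = 0) by omega),
        if_neg (show ¬ (((t + 1 : ℕ) : ℤ) + 1 = -1) by omega),
        if_neg (show ¬ (((t + 1 : ℕ) : ℤ) + 1 = 0) by omega),
        show (((t + 1 : ℕ) : ℤ) + 1 - 1 - 1).toNat = t by omega,
        show (((t + 1 : ℕ) : ℤ) + 1 - 1).toNat = t + 1 by omega,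
        show (((t + 1 : ℕ) : ℤ) + 1 + 1 - 1).toNat = t + 2 by omega,
        show (((t + 1 : ℕ) : ℤ) + 1 + 1).toNat = t + 3 by omega,
        show (((t + 1 : ℕ) : ℤ) + 1).toNat = t + 2 by omega]
      have h1 := continuant_add_two a k₀ (t + 1)
      have h2 := continuant_add_two a (k₀ + 1) t
      rw [show k₀ + ((t + 1 : ℕ) : ℤ) + 1 = k₀ + (((t + 1 : ℕ) : ℤ) + 1) by ring] at h1
      rw [show k₀ + 1 + (t : ℤ) + 1 = k₀ + (((t + 1 : ℕ) : ℤ) + 1) by push_cast; ring] at h2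
      rw [show t + 3 = t + 1 + 2 from rfl, h1, h2]
      ring

end PolygonDissection

/-! ### The part of the strip between a bridging arc and one of its translates -/

namespace Surface

variable (S : Surface)

lemma deck_outer (z k : ℤ) : S.deck z (.outer k) = .outer (k + z * S.n) := rfl

lemma deck_lt_deck (z : ℤ) {x y : CoverVertex} : S.deck z x < S.deck z y ↔ x < y := by
  cases S <;> cases x <;> cases y <;>
    simp [Surface.deck, CoverVertex.lt_def, CoverVertex.position, Prod.Lex.lt_iff]
  omega

lemma deck_neg_deck (z : ℤ) (x : CoverVertex) : S.deck (-z) (S.deck z x) = x := by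
  have := DFunLike.congr_fun (S.deck_add z (-z)) x
  rw [add_neg_cancel, S.deck_zero] at this
  exact this.symm

lemma deck_deck_neg (z : ℤ) (x : CoverVertex) : S.deck z (S.deck (-z) x) = x := by
  have := S.deck_neg_deck (-z) x
  rwa [neg_neg] at this

lemma IsBoundarySegment.deck {S : Surface} {x y : CoverVertex} (h : S.IsBoundarySegment x y)
    (z : ℤ) : S.IsBoundarySegment (S.deck z x) (S.deck z y) := by
  cases S <;> cases x <;> cases y <;> simp [Surface.IsBoundarySegment, Surface.deck] at h ⊢ <;>
    omega

lemma IsBoundarySegment.lt {S : Surface} {x y : CoverVertex} (h : S.IsBoundarySegment x y) :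
    x < y := by
  cases S <;> cases x <;> cases y <;> simp [Surface.IsBoundarySegment] at h ⊢ <;> omega

namespace Dissection

variable {S} (D : S.Dissection)

/-- The boundary segments and the arcs of the dissected strip. -/
def Edge (x y : CoverVertex) : Prop := S.IsBoundarySegment x y ∨ (x, y) ∈ D.arcs

variable {D}

lemma Edge.noncrossing {a b x y : CoverVertex} (hab : D.Edge a b) (hxy : D.Edge x y) :
    ¬ (a < x ∧ x < b ∧ b < y) := by
  rintro ⟨h1, h2, h3⟩
  rcases hab with h | h
  · exact h.not_between h1 h2
  rcases hxy with h' | h'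
  · exact h'.not_between h2 h3
  · exact D.noncrossing _ _ _ _ h h' ⟨h1, h2, h3⟩

lemma mem_arcs_deck_iff (z : ℤ) {x y : CoverVertex} :
    (S.deck z x, S.deck z y) ∈ D.arcs ↔ (x, y) ∈ D.arcs := by
  refine ⟨fun h => ?_, D.deck_mem z x y⟩
  have := D.deck_mem (-z) _ _ h
  rwa [S.deck_neg_deck, S.deck_neg_deck] at this

lemma isBoundarySegment_deck_iff (z : ℤ) {x y : CoverVertex} :
    S.IsBoundarySegment (S.deck z x) (S.deck z y) ↔ S.IsBoundarySegment x y := by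
  refine ⟨fun h => ?_, fun h => h.deck z⟩
  have := h.deck (-z)
  rwa [S.deck_neg_deck, S.deck_neg_deck] at this

lemma IsSubgon.deck {s : Finset CoverVertex} (hs : D.IsSubgon s) (z : ℤ) :
    D.IsSubgon (s.map (S.deck z).toEmbedding) := by
  refine ⟨by rw [Finset.card_map]; exact hs.1, ?_⟩
  have hc : ∀ x y, ConsecutiveIn (s.map (S.deck z).toEmbedding) (S.deck z x) (S.deck z y) ↔
      ConsecutiveIn s x y := by
    intro x y
    simp only [ConsecutiveIn, Finset.forall_mem_map, Equiv.coe_toEmbedding, S.deck_lt_deck]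
  intro x hx y hy hxy
  obtain ⟨x, hx', rfl⟩ := Finset.mem_map.1 hx
  obtain ⟨y, hy', rfl⟩ := Finset.mem_map.1 hy
  simp only [Equiv.coe_toEmbedding] at hxy ⊢
  rw [hc, isBoundarySegment_deck_iff, mem_arcs_deck_iff]
  exact hs.2 x hx' y hy' ((S.deck_lt_deck z).1 hxy)

/-- The image of a subgon of the strip under a deck transformation. -/
def CoverSubgon.deck (P : D.CoverSubgon) (z : ℤ) : D.CoverSubgon :=
  ⟨P.1.map (S.deck z).toEmbedding, P.2.deck z⟩

lemma CoverSubgon.mem_deck {P : D.CoverSubgon} {z : ℤ} {x : CoverVertex} :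
    S.deck z x ∈ (P.deck z).1 ↔ x ∈ P.1 :=
  Finset.mem_map' _

lemma CoverSubgon.proj_deck (P : D.CoverSubgon) (z : ℤ) : (P.deck z).proj = P.proj :=
  Quotient.sound (D.liftSetoid.symm ⟨z, rfl⟩)

lemma CoverSubgon.deck_neg_deck (P : D.CoverSubgon) (z : ℤ) : (P.deck z).deck (-z) = P := by
  refine Subtype.ext ?_
  ext x
  have h1 := CoverSubgon.mem_deck (P := P.deck z) (z := -z) (x := S.deck z x)
  rw [S.deck_neg_deck, CoverSubgon.mem_deck] at h1
  exact h1

lemma CoverSubgon.deck_deck_neg (P : D.CoverSubgon) (z : ℤ) : (P.deck (-z)).deck z = P := by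
  have := P.deck_neg_deck (-z)
  rwa [neg_neg] at this

/-- The sum of a function on the subgons of the surface over the subgons incident to a vertex. -/
noncomputable def sumAt {A : Type*} [AddCommMonoid A] (F : D.Subgon → A) (k : ℤ) : A :=
  ∑ P : D.SubgonsAt k, F P.1.proj

lemma sumAt_add_n {A : Type*} [AddCommMonoid A] (F : D.Subgon → A) (k : ℤ) :
    sumAt F (k + S.n) = sumAt F k := by
  symm
  have hk : S.deck 1 (.outer k) = .outer (k + S.n) := by rw [S.deck_outer, one_mul]
  refine Finset.sum_bij (fun P _ => ⟨P.1.deck 1, by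
    rw [← hk]; exact CoverSubgon.mem_deck.2 P.2⟩) (fun _ _ => Finset.mem_univ _) ?_ ?_ ?_
  · intro P _ Q _ h
    refine Subtype.ext ?_
    rw [← P.1.deck_neg_deck 1, ← Q.1.deck_neg_deck 1]
    exact congrArg (fun R : D.SubgonsAt (k + S.n) => R.1.deck (-1)) h
  · intro Q _
    refine ⟨⟨Q.1.deck (-1), ?_⟩, Finset.mem_univ _, Subtype.ext (Q.1.deck_deck_neg 1)⟩
    have := S.deck_neg_deck 1 (.outer k)
    rw [← this, hk]
    exact CoverSubgon.mem_deck.2 Q.2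
  · intro P _
    rw [CoverSubgon.proj_deck]

variable (D)

/-- The part of the strip between a bridging arc at `outer k₀` and its `z`-th translate, as a
polygon with vertices `φ 0, …, φ N`; the vertices `φ 0, …, φ M` are those on the lower boundary. -/
structure Window (k₀ z M N : ℤ) where
  /-- The enumeration of the vertices. -/
  φ : ℤ → CoverVertex
  pos : 0 < M
  lt : M < N
  outer : ∀ t, 0 ≤ t → t ≤ M → φ t = .outer (k₀ + t)
  mono : ∀ s t, 0 ≤ s → s < t → t ≤ N → φ s < φ t
  step : ∀ t, 0 ≤ t → t < N → D.Edge (φ t) (φ (t + 1))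
  root : (φ 0, φ N) ∈ D.arcs
  deck_left : S.deck z (φ 0) = φ M
  deck_right : S.deck z (φ N) = φ (M + 1)
  surj : ∀ v, φ 0 ≤ v → v ≤ φ N → ¬ (φ M < v ∧ v < φ (M + 1)) → ∃ t, 0 ≤ t ∧ t ≤ N ∧ φ t = v

variable {D}

/-- The boundary of the region is the lower boundary from `k₀` to `k₀ + z * n`, the translated arc,
and then the upper boundary traversed backwards to the end of the first arc. Over a punctured disc
both arcs end at the fixed point `+∞`, so `N = M + 1`. -/
lemma exists_window {k₀ : ℤ} {y : CoverVertex} (h : (.outer k₀, y) ∈ D.arcs)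
    (hy : ¬ ∃ l, y = .outer l) {z : ℤ} (hz : 0 < z) :
    ∃ N, Nonempty (D.Window k₀ z (z * S.n) N) := by
  have harc := D.isArc _ _ h
  have hdeck := D.deck_mem z _ _ h
  have hn : (1 : ℤ) ≤ S.n := by exact_mod_cast S.one_le_n
  have hM : 0 < z * (S.n : ℤ) := by positivity
  cases S with
  | annulus n m hn' hm =>
    cases y with
    | outer l => exact absurd ⟨l, rfl⟩ hy
    | puncture => exact harc.elim
    | inner l =>
      simp only [Surface.n, Surface.deck, Equiv.coe_fn_mk] at hM hdeck ⊢
      have hm' : 0 < z * (m : ℤ) := by positivity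
      generalize hMd : z * (n : ℤ) = M at hM hdeck ⊢
      generalize hK : z * (m : ℤ) = K at hm' hdeck
      refine ⟨M + 1 + K, ⟨⟨fun t => if t ≤ M then .outer (k₀ + t) else .inner (l + K - (t - M - 1)),
        hM, by omega, fun t _ ht => if_pos ht, ?_, ?_, ?_, ?_, ?_, ?_⟩⟩⟩
      · intro s t h1 h2 h3
        split_ifs <;> first | (exfalso; omega) | (simp; done) | (simp; omega)
      · intro t h1 h2
        split_ifs with h3 h4 h4
        · left
          simp only [Surface.IsBoundarySegment]
          omega
        · right
          rw [show t = M by omega, show l + K - (M + 1 - M - 1) = l + K by ring]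
          exact hdeck
        · omega
        · left
          simp only [Surface.IsBoundarySegment]
          omega
      · rw [if_pos hM.le, if_neg (by omega), add_zero,
          show l + K - (M + 1 + K - M - 1) = l by ring]
        exact h
      · rw [if_pos hM.le, if_pos le_rfl]
        simp [Surface.deck, Surface.n, hMd]
      · rw [if_neg (by omega), if_neg (by omega)]
        simp [Surface.deck, hK]
        ring
      · rw [if_pos hM.le, if_neg (by omega), if_pos le_rfl, if_neg (by omega), add_zero,
          show l + K - (M + 1 + K - M - 1) = l by ring,
          show l + K - (M + 1 - M - 1) = l + K by ring]
        intro v h1 h2 h3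
        cases v with
        | outer j =>
          rw [← not_lt, CoverVertex.outer_lt_outer] at h1
          simp only [CoverVertex.outer_lt_outer, CoverVertex.outer_lt_inner, and_true] at h3
          exact ⟨j - k₀, by omega, by omega, by rw [if_pos (by omega)]; congr 1; ring⟩
        | inner j =>
          rw [← not_lt, CoverVertex.inner_lt_inner] at h2
          simp only [CoverVertex.inner_lt_inner, CoverVertex.outer_lt_inner, true_and] at h3
          exact ⟨M + 1 + (l + K - j), by omega, by omega, by
            rw [if_neg (by omega)]; congr 1; ring⟩
        | puncture => exact absurd CoverVertex.inner_lt_puncture (not_lt.2 h2)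
  | puncturedDisc n hn' =>
    cases y with
    | outer l => exact absurd ⟨l, rfl⟩ hy
    | inner l => exact harc.elim
    | puncture =>
      simp only [Surface.n, Surface.deck, Equiv.coe_fn_mk] at hM hdeck ⊢
      generalize hMd : z * (n : ℤ) = M at hM hdeck ⊢
      refine ⟨M + 1, ⟨⟨fun t => if t ≤ M then .outer (k₀ + t) else .puncture,
        hM, by omega, fun t _ ht => if_pos ht, ?_, ?_, ?_, ?_, ?_, ?_⟩⟩⟩
      · intro s t h1 h2 h3
        split_ifs <;> first | (exfalso; omega) | (simp; done) | (simp; omega)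
      · intro t h1 h2
        rw [if_pos (by omega)]
        split_ifs with h3
        · left
          simp only [Surface.IsBoundarySegment]
          omega
        · right
          rw [show t = M by omega]
          exact hdeck
      · rw [if_pos hM.le, if_neg (by omega), add_zero]
        exact h
      · rw [if_pos hM.le, if_pos le_rfl]
        simp [Surface.deck, Surface.n, hMd]
      · rw [if_neg (by omega)]
        simp [Surface.deck]
      · rw [if_pos hM.le, if_neg (by omega), if_pos le_rfl, add_zero]
        intro v h1 h2 h3
        cases v with
        | outer j =>
          rw [← not_lt, CoverVertex.outer_lt_outer] at h1
          simp only [CoverVertex.outer_lt_outer, CoverVertex.outer_lt_puncture, and_true] at h3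
          exact ⟨j - k₀, by omega, by omega, by rw [if_pos (by omega)]; congr 1; ring⟩
        | inner j => exact absurd ⟨CoverVertex.outer_lt_inner, CoverVertex.inner_lt_puncture⟩ h3
        | puncture => exact ⟨M + 1, by omega, le_rfl, if_neg (by omega)⟩

/-! ### Subgons between two bridging arcs -/

namespace Window

variable {k₀ z M N : ℤ} (W : D.Window k₀ z M N)

lemma lt_iff {s t : ℤ} (hs : 0 ≤ s ∧ s ≤ N) (ht : 0 ≤ t ∧ t ≤ N) : W.φ s < W.φ t ↔ s < t := by
  refine ⟨fun h => ?_, fun h => W.mono s t hs.1 h ht.2⟩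
  by_contra hlt
  rcases (not_lt.1 hlt).eq_or_lt with rfl | h'
  · exact lt_irrefl _ h
  · exact lt_asymm h (W.mono t s ht.1 h' hs.2)

lemma injOn : Set.InjOn W.φ (Set.Icc 0 N) := by
  intro s hs t ht h
  have h1 := W.lt_iff hs ht
  have h2 := W.lt_iff ht hs
  rw [h] at h1 h2
  simp only [lt_self_iff_false, false_iff] at h1 h2
  omega

lemma arc_right : (W.φ M, W.φ (M + 1)) ∈ D.arcs := by
  rw [← W.deck_left, ← W.deck_right]
  exact D.deck_mem z _ _ W.root

/-- The dissected polygon between the two arcs. -/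
def polygon : PolygonDissection N where
  edge s t := 0 ≤ s ∧ s < t ∧ t ≤ N ∧ D.Edge (W.φ s) (W.φ t)
  range h := ⟨h.1, h.2.1, h.2.2.1⟩
  step h1 h2 := ⟨h1, by omega, by omega, W.step _ h1 h2⟩
  root := ⟨le_rfl, W.pos.trans W.lt, le_rfl, Or.inr W.root⟩
  noncrossing := by
    rintro a b x y ⟨h1, h2, h3, h4⟩ ⟨h5, h6, h7, h8⟩ ⟨h9, h10, h11⟩
    exact h4.noncrossing h8 ⟨W.mono _ _ h1 h9 (by omega), W.mono _ _ h5 h10 (by omega),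
      W.mono _ _ (by omega) h11 (by omega)⟩

variable {W}

lemma range_of_mem {e : W.polygon.Cell} {k : ℤ} (hk : k ∈ e.verts) : 0 ≤ k ∧ k ≤ N := by
  have h1 := W.polygon.range e.2.1
  have h2 := (PolygonDissection.Cell.mem_verts.1 hk).1
  omega

/-- Cyclic neighbours are either consecutive in the linear order, and then joined by an edge, or the
first and last vertices, joined by the longest side. A diagonal in the dissection would hide some
vertex of the cell. -/
lemma isSubgon_image (e : W.polygon.Cell) : D.IsSubgon (e.verts.image W.φ) := by
  have hinj : Set.InjOn W.φ e.verts := W.injOn.mono fun k hk => range_of_mem hk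
  refine ⟨by rw [Finset.card_image_of_injOn hinj]; exact e.three_le_size, ?_⟩
  intro x hx y hy hxy
  obtain ⟨s, hs, rfl⟩ := Finset.mem_image.1 hx
  obtain ⟨t, ht, rfl⟩ := Finset.mem_image.1 hy
  have hs' := range_of_mem hs
  have ht' := range_of_mem ht
  rw [W.lt_iff hs' ht'] at hxy
  have hs1 := PolygonDissection.Cell.mem_verts.1 hs
  have ht1 := PolygonDissection.Cell.mem_verts.1 ht
  have hcon : ConsecutiveIn (e.verts.image W.φ) (W.φ s) (W.φ t) ↔
      (∀ k ∈ e.verts, ¬ (s < k ∧ k < t)) ∨ (∀ k ∈ e.verts, ¬ (k < s ∨ t < k)) := by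
    simp only [ConsecutiveIn, Finset.forall_mem_image]
    refine or_congr (forall₂_congr fun k hk => ?_) (forall₂_congr fun k hk => ?_)
    · rw [W.lt_iff hs' (range_of_mem hk), W.lt_iff (range_of_mem hk) ht']
    · rw [W.lt_iff (range_of_mem hk) hs', W.lt_iff ht' (range_of_mem hk)]
  rw [hcon]
  constructor
  · rintro (h | h)
    · exact (PolygonDissection.edge_of_consecutive e.2.1 e.2.2 hxy hs ht h).1.2.2.2
    · have h1 := h _ e.left_mem
      have h2 := h _ e.right_mem
      rw [show s = e.1.1 by omega, show t = e.1.2 by omega]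
      exact e.2.1.2.2.2
  · rintro h harc
    push Not at h
    obtain ⟨⟨k, hk, h1, h2⟩, ⟨l, hl, h3⟩⟩ := h
    have hl1 := (PolygonDissection.Cell.mem_verts.1 hl).1
    have := (PolygonDissection.Cell.mem_verts.1 hk).2 s t
      ⟨hs'.1, hxy, ht'.2, Or.inr harc⟩ hs1.1.1 ht1.1.2 h1 h2
    omega

/-- A subgon of the polygon, as a subgon of the strip. -/
noncomputable def subgon (e : W.polygon.Cell) : D.CoverSubgon := ⟨e.verts.image W.φ, isSubgon_image e⟩

lemma size_subgon (e : W.polygon.Cell) : (subgon e).size = e.size :=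
  Finset.card_image_of_injOn (W.injOn.mono fun _ hk => range_of_mem hk)

lemma mem_subgon {e : W.polygon.Cell} {t : ℤ} (ht : 0 ≤ t ∧ t ≤ N) :
    W.φ t ∈ (subgon e).1 ↔ t ∈ e.verts := by
  refine ⟨fun h => ?_, fun h => Finset.mem_image_of_mem _ h⟩
  obtain ⟨s, hs, hst⟩ := Finset.mem_image.1 h
  rwa [← W.injOn (range_of_mem hs) ht hst]

lemma subgon_injective : Function.Injective (subgon : W.polygon.Cell → D.CoverSubgon) := by
  have key : ∀ e f : W.polygon.Cell, subgon e = subgon f → ∀ k ∈ e.verts, k ∈ f.verts := by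
    intro e f h k hk
    rw [← mem_subgon (range_of_mem hk), ← h]
    exact (mem_subgon (range_of_mem hk)).2 hk
  intro e f h
  have h1 := (PolygonDissection.Cell.mem_verts.1 (key e f h _ e.left_mem)).1
  have h2 := (PolygonDissection.Cell.mem_verts.1 (key e f h _ e.right_mem)).1
  have h3 := (PolygonDissection.Cell.mem_verts.1 (key f e h.symm _ f.left_mem)).1
  have h4 := (PolygonDissection.Cell.mem_verts.1 (key f e h.symm _ f.right_mem)).1
  exact PolygonDissection.Cell.ext' (by omega) (by omega)

/-- The smallest and largest indices of `P` give the longest side. No arc below it separates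
vertices of `P`, so all of them belong to the cell. A further vertex of the cell would lie strictly
between two neighbours in `P`, whose side would have to be the longest one, leaving `P` with two
vertices. -/
lemma exists_subgon_eq (P : D.CoverSubgon)
    (hP : ∀ v ∈ P.1, ∃ t, 0 ≤ t ∧ t ≤ N ∧ W.φ t = v) : ∃ e : W.polygon.Cell, subgon e = P := by
  classical
  obtain ⟨s, hs⟩ := P
  set T := (Finset.Icc 0 N).filter fun t => W.φ t ∈ s with hT
  have hmemT : ∀ t, t ∈ T ↔ (0 ≤ t ∧ t ≤ N) ∧ W.φ t ∈ s := fun t => by simp [hT]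
  have hsT : T.image W.φ = s := by
    ext v
    rw [Finset.mem_image]
    constructor
    · rintro ⟨t, ht, rfl⟩
      exact ((hmemT t).1 ht).2
    · intro hv
      obtain ⟨t, h1, h2, rfl⟩ := hP v hv
      exact ⟨t, (hmemT t).2 ⟨⟨h1, h2⟩, hv⟩, rfl⟩
  have hcard : 3 ≤ T.card := by
    have := hs.1
    rw [← hsT] at this
    exact this.trans Finset.card_image_le
  have hne : T.Nonempty := Finset.card_pos.1 (by omega)
  set a := T.min' hne
  set c := T.max' hne
  have ha := (hmemT a).1 (T.min'_mem hne)
  have hc := (hmemT c).1 (T.max'_mem hne)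
  have hac : ∀ t ∈ T, a ≤ t ∧ t ≤ c := fun t ht => ⟨T.min'_le t ht, T.le_max' t ht⟩
  have hac2 : a + 2 ≤ c := by
    have h1 : T ⊆ Finset.Icc a c := fun t ht => Finset.mem_Icc.2 (hac t ht)
    have h2 := Finset.card_le_card h1
    rw [Int.card_Icc] at h2
    omega
  have hacE : D.Edge (W.φ a) (W.φ c) := by
    refine (hs.2 _ ha.2 _ hc.2 ((W.lt_iff ha.1 hc.1).2 (by omega))).1 (Or.inr ?_)
    intro v hv
    rw [← hsT] at hv
    obtain ⟨t, ht, rfl⟩ := Finset.mem_image.1 hv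
    have := hac t ht
    rw [W.lt_iff ((hmemT t).1 ht).1 ha.1, W.lt_iff hc.1 ((hmemT t).1 ht).1]
    omega
  refine ⟨⟨(a, c), ⟨ha.1.1, by omega, hc.1.2, hacE⟩, hac2⟩, Subtype.ext ?_⟩
  change (PolygonDissection.top _ a c).image W.φ = s
  rw [← hsT]
  congr 1
  have hsub : ∀ t ∈ T, t ∈ W.polygon.top a c := by
    intro t ht
    refine PolygonDissection.mem_top.2 ⟨hac t ht, fun x y hxy h1 h2 h3 h4 => ?_⟩
    by_contra hne'
    obtain ⟨ht1, ht2⟩ := (hmemT t).1 ht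
    obtain ⟨h5, h6, h7, h8 | h8⟩ := hxy
    · exact h8.not_between (W.mono x t h5 h3 ht1.2) (W.mono t y ht1.1 h4 h7)
    · by_cases hx : a < x
      · exact D.not_separated hs h8 ht2 (W.mono x t h5 h3 ht1.2) (W.mono t y ht1.1 h4 h7) ha.2
          (Or.inl (W.mono a x ha.1.1 hx (by omega)))
      · exact D.not_separated hs h8 ht2 (W.mono x t h5 h3 ht1.2) (W.mono t y ht1.1 h4 h7) hc.2
          (Or.inr (W.mono y c (by omega) (by omega) hc.1.2))
  refine Finset.Subset.antisymm ?_ hsub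
  intro k hk
  by_contra hkT
  have hk' := PolygonDissection.mem_top.1 hk
  have hka : k ≠ a := fun h => hkT (h ▸ T.min'_mem hne)
  have hkc : k ≠ c := fun h => hkT (h ▸ T.max'_mem hne)
  have hne1 : (T.filter (· < k)).Nonempty :=
    ⟨a, Finset.mem_filter.2 ⟨T.min'_mem hne, by omega⟩⟩
  have hne2 : (T.filter (k < ·)).Nonempty :=
    ⟨c, Finset.mem_filter.2 ⟨T.max'_mem hne, by omega⟩⟩
  set x := (T.filter (· < k)).max' hne1
  set y := (T.filter (k < ·)).min' hne2
  have hx := Finset.mem_filter.1 ((T.filter (· < k)).max'_mem hne1)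
  have hy := Finset.mem_filter.1 ((T.filter (k < ·)).min'_mem hne2)
  have hx' := (hmemT x).1 hx.1
  have hy' := (hmemT y).1 hy.1
  have hxk : x < k := hx.2
  have hky : k < y := hy.2
  have hbet : ∀ t ∈ T, ¬ (x < t ∧ t < y) := by
    rintro t ht ⟨h1, h2⟩
    rcases lt_trichotomy t k with h | h | h
    · have := (T.filter (· < k)).le_max' t (Finset.mem_filter.2 ⟨ht, h⟩)
      omega
    · exact hkT (h ▸ ht)
    · have := (T.filter (k < ·)).min'_le t (Finset.mem_filter.2 ⟨ht, h⟩)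
      omega
  have hE : D.Edge (W.φ x) (W.φ y) := by
    refine (hs.2 _ hx'.2 _ hy'.2 ((W.lt_iff hx'.1 hy'.1).2 (by omega))).1 (Or.inl ?_)
    intro v hv
    rw [← hsT] at hv
    obtain ⟨t, ht, rfl⟩ := Finset.mem_image.1 hv
    rw [W.lt_iff hx'.1 ((hmemT t).1 ht).1, W.lt_iff ((hmemT t).1 ht).1 hy'.1]
    exact hbet t ht
  have hfin := hk'.2 x y ⟨hx'.1.1, by omega, hy'.1.2, hE⟩ (hac x hx.1).1 (hac y hy.1).2 hxk hky
  have hTsub : T ⊆ {a, c} := by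
    intro t ht
    have h1 := hac t ht
    have h2 := hbet t ht
    simp only [Finset.mem_insert, Finset.mem_singleton]
    omega
  have := (Finset.card_le_card hTsub).trans Finset.card_le_two
  omega

/-- A subgon with a vertex strictly below the first arc and a vertex that is not below the second
arc lies between the two arcs. -/
lemma exists_subgon_eq_of_mem (P : D.CoverSubgon) {u v : CoverVertex} (hu : u ∈ P.1)
    (hu0 : W.φ 0 < u) (huN : u < W.φ N) (hv : v ∈ P.1) (hvM : v < W.φ M ∨ W.φ (M + 1) < v) :
    ∃ e : W.polygon.Cell, subgon e = P := by
  refine exists_subgon_eq P fun w hw => W.surj w ?_ ?_ ?_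
  · by_contra h
    exact D.not_separated P.2 W.root hu hu0 huN hw (Or.inl (not_le.1 h))
  · by_contra h
    exact D.not_separated P.2 W.root hu hu0 huN hw (Or.inr (not_le.1 h))
  · rintro ⟨h1, h2⟩
    exact D.not_separated P.2 W.arc_right hw h1 h2 hv hvM

/-- A subgon at a lower vertex strictly between the two arcs cannot cross either of them, so it is
seen in the polygon. -/
lemma sumAt_eq {A : Type*} [AddCommMonoid A] (F : D.Subgon → A) {t : ℤ} (h1 : 0 < t) (h2 : t < M) :
    sumAt F (k₀ + t) = ∑ e ∈ W.polygon.cellsAt t, F (subgon e).proj := by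
  have hlt := W.lt
  have ht := W.outer t h1.le h2.le
  have htN : 0 ≤ t ∧ t ≤ N := by omega
  symm
  refine Finset.sum_bij (fun e he => ⟨subgon e, by
    rw [← ht, mem_subgon htN]; exact PolygonDissection.mem_cellsAt.1 he⟩)
    (fun _ _ => Finset.mem_univ _) ?_ ?_ (fun _ _ => rfl)
  · intro e _ f _ h
    exact subgon_injective (congrArg (fun P : D.SubgonsAt (k₀ + t) => P.1) h)
  · intro P _
    obtain ⟨e, he⟩ := exists_subgon_eq_of_mem (W := W) P.1 P.2
      (by rw [← ht]; exact W.mono 0 t le_rfl h1 htN.2)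
      (by rw [← ht]; exact W.mono t N htN.1 (by omega) le_rfl) P.2
      (Or.inl (by rw [← ht]; exact W.mono t M htN.1 h2 W.lt.le))
    refine ⟨e, ?_, Subtype.ext he⟩
    rw [PolygonDissection.mem_cellsAt, ← mem_subgon htN, he, ht]
    exact P.2

/-- A subgon of the polygon has a vertex strictly below the first arc. -/
lemma exists_mem_between (e : W.polygon.Cell) : ∃ v ∈ (subgon e).1, W.φ 0 < v ∧ v < W.φ N := by
  have h1 := e.card_inner
  have h2 := e.three_le_size
  obtain ⟨k, hk⟩ : e.inner.Nonempty := Finset.card_pos.1 (by omega)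
  obtain ⟨h3, h4, h5⟩ := PolygonDissection.Cell.mem_inner.1 hk
  have h6 := W.polygon.range e.2.1
  exact ⟨_, (mem_subgon (range_of_mem h3)).2 h3, W.mono _ _ le_rfl (by omega) (by omega),
    W.mono _ _ (by omega) (by omega) le_rfl⟩

/-- No vertex of a subgon of the polygon is strictly below the second arc. -/
lemma not_mem_between (e : W.polygon.Cell) {v : CoverVertex} (hv : v ∈ (subgon e).1) :
    ¬ (W.φ M < v ∧ v < W.φ (M + 1)) := by
  obtain ⟨k, hk, rfl⟩ := Finset.mem_image.1 hv
  have h0 := W.pos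
  have h1 := W.lt
  rw [W.lt_iff (by omega) (range_of_mem hk), W.lt_iff (range_of_mem hk) (by omega)]
  omega

/-- The bridging arc divides the subgons at `k₀`: those to its right appear in the polygon at the
vertex `0`, and the `z`-th translates of those to its left appear at `M`. The function `F` does not
see the translation. -/
lemma sumAt_zero {A : Type*} [AddCommMonoid A] (F : D.Subgon → A) :
    sumAt F k₀ = ∑ e ∈ W.polygon.cellsAt 0, F (subgon e).proj +
      ∑ e ∈ W.polygon.cellsAt M, F (subgon e).proj := by
  classical
  have hpos := W.pos
  have hlt := W.lt
  have h0 : W.φ 0 = .outer k₀ := by rw [W.outer 0 le_rfl hpos.le, add_zero]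
  have h0M : W.φ 0 < W.φ M := W.mono _ _ le_rfl hpos hlt.le
  rw [sumAt, ← Finset.sum_filter_add_sum_filter_not _
    (fun P : D.SubgonsAt k₀ => ∃ v ∈ P.1.1, W.φ 0 < v ∧ v < W.φ N)]
  congr 1
  · symm
    refine Finset.sum_bij (fun e he => ⟨subgon e, by
      rw [← h0, mem_subgon (by omega)]; exact PolygonDissection.mem_cellsAt.1 he⟩)
      ?_ ?_ ?_ (fun _ _ => rfl)
    · intro e _
      exact Finset.mem_filter.2 ⟨Finset.mem_univ _, exists_mem_between e⟩
    · intro e _ f _ h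
      exact subgon_injective (congrArg (fun P : D.SubgonsAt k₀ => P.1) h)
    · intro P hP
      obtain ⟨v, hv, hv1, hv2⟩ := (Finset.mem_filter.1 hP).2
      obtain ⟨e, he⟩ := exists_subgon_eq_of_mem (W := W) P.1 hv hv1 hv2 P.2
        (Or.inl (by rw [← h0]; exact h0M))
      refine ⟨e, ?_, Subtype.ext he⟩
      rw [PolygonDissection.mem_cellsAt, ← mem_subgon (by omega), he, h0]
      exact P.2
  · symm
    have hback : S.deck (-z) (W.φ M) = W.φ 0 := by rw [← W.deck_left, S.deck_neg_deck]
    refine Finset.sum_bij (fun e he => ⟨(subgon e).deck (-z), by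
      rw [← h0, ← hback, CoverSubgon.mem_deck, mem_subgon (by omega)]
      exact PolygonDissection.mem_cellsAt.1 he⟩) ?_ ?_ ?_ ?_
    · intro e _
      refine Finset.mem_filter.2 ⟨Finset.mem_univ _, ?_⟩
      rintro ⟨v, hv, hv1, hv2⟩
      rw [← S.deck_neg_deck z v] at hv
      rw [CoverSubgon.mem_deck] at hv
      refine not_mem_between e hv ?_
      rw [← W.deck_left, ← W.deck_right, S.deck_lt_deck, S.deck_lt_deck]
      exact ⟨hv1, hv2⟩
    · intro e _ f _ h
      have h1 : (subgon e).deck (-z) = (subgon f).deck (-z) :=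
        congrArg (fun P : D.SubgonsAt k₀ => P.1) h
      refine subgon_injective ?_
      rw [← (subgon e).deck_deck_neg z, h1, CoverSubgon.deck_deck_neg]
    · intro P hP
      have hP' := (Finset.mem_filter.1 hP).2
      have hM : W.φ M ∈ (P.1.deck z).1 := by
        rw [← W.deck_left, CoverSubgon.mem_deck, h0]
        exact P.2
      obtain ⟨e, he⟩ : ∃ e : W.polygon.Cell, subgon e = P.1.deck z := by
        refine exists_subgon_eq _ fun w hw => W.surj w ?_ ?_ ?_
        · by_contra h
          exact D.not_separated (P.1.deck z).2 W.root hM h0M (W.mono _ _ hpos.le hlt le_rfl) hw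
            (Or.inl (not_le.1 h))
        · by_contra h
          exact D.not_separated (P.1.deck z).2 W.root hM h0M (W.mono _ _ hpos.le hlt le_rfl) hw
            (Or.inr (not_le.1 h))
        · rintro ⟨h1, h2⟩
          rw [← S.deck_deck_neg z w] at h1 h2 hw
          rw [← W.deck_left, S.deck_lt_deck] at h1
          rw [← W.deck_right, S.deck_lt_deck] at h2
          exact hP' ⟨_, CoverSubgon.mem_deck.1 hw, h1, h2⟩
      refine ⟨e, ?_, Subtype.ext ?_⟩
      · rw [PolygonDissection.mem_cellsAt, ← mem_subgon (by omega), he]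
        exact hM
      · simp only [he]
        exact P.1.deck_neg_deck z
    · intro e _
      rw [CoverSubgon.proj_deck]

end Window

end Dissection

end Surface

/-! ### Weighted matchings on the surface and the growth coefficient -/

namespace Surface.Dissection

open MvPolynomial

variable {S : Surface} {D : S.Dissection}

lemma Subgon.three_le_size (P : D.Subgon) : 3 ≤ P.size := by
  induction P using Quotient.inductionOn with
  | _ P => exact P.2.1

/-- The annulus weight as a value of a linear functional on polynomials. -/
lemma annulusWeight_eq {i j : ℤ} (w : D.Matching i j) :
    annulusWeight w = weightFunctional (fun P : D.Subgon => truncatedWeight P.size)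
      (∏ k, X (w k).1.proj) := by
  classical
  rw [monomial_sum_single, weightFunctional_monomial, one_mul]
  set m : D.Subgon →₀ ℕ := ∑ k, Finsupp.single (w k).1.proj 1 with hm
  have hmult : ∀ P, m P = multiplicity w P := fun P => by
    rw [hm, sum_single_apply, multiplicity]
  rw [annulusWeight]
  split_ifs with h
  · obtain ⟨P, hP⟩ := h
    have := P.three_le_size
    refine (Finset.prod_eq_zero (i := P) ?_ ?_).symm
    · rw [Finsupp.mem_support_iff, hmult]
      omega
    · change truncatedWeight P.size (m P) = 0
      rw [truncatedWeight, hmult, if_pos hP]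
  · push Not at h
    rw [finprod_eq_prod_of_mulSupport_subset (s := m.support)]
    · refine Finset.prod_congr rfl fun P _ => ?_
      change _ = truncatedWeight P.size (m P)
      rw [truncatedWeight, hmult, if_neg (not_lt.2 (h P))]
    · intro P hP
      rw [Finset.mem_coe, Finsupp.mem_support_iff, hmult]
      intro h0
      exact hP (by simp only [h0, chebyshevValue_zero])

/-- The choices at different vertices are independent, so expanding the product of sums of variables
enumerates the matchings. -/
lemma sum_annulusWeight (i j : ℤ) :
    ∑ w : D.Matching i j, annulusWeight w =
      weightFunctional (fun P : D.Subgon => truncatedWeight P.size)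
        (∏ k ∈ Finset.Ioo i j, sumAt (X : D.Subgon → MvPolynomial D.Subgon ℝ) k) := by
  classical
  rw [← Finset.prod_coe_sort]
  simp only [sumAt]
  rw [Finset.prod_univ_sum, map_sum, Fintype.piFinset_univ]
  exact Finset.sum_congr rfl fun w _ => annulusWeight_eq w

/-- Moving on by one vertex replaces the factor at `i + 1` by the one at `i + 1 + n`. They are the
same polynomial, since the variables are indexed by subgons of the surface and not of the strip. -/
lemma prod_sumAt_shift (i j : ℤ) :
    ∏ k ∈ Finset.Ioo i (i + S.n + 1), sumAt (X : D.Subgon → MvPolynomial D.Subgon ℝ) k =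
      ∏ k ∈ Finset.Ioo j (j + S.n + 1), sumAt (X : D.Subgon → MvPolynomial D.Subgon ℝ) k := by
  have hn := S.one_le_n
  have step : ∀ i : ℤ,
      ∏ k ∈ Finset.Ioo i (i + S.n + 1), sumAt (X : D.Subgon → MvPolynomial D.Subgon ℝ) k =
      ∏ k ∈ Finset.Ioo (i + 1) (i + 1 + S.n + 1),
        sumAt (X : D.Subgon → MvPolynomial D.Subgon ℝ) k := by
    intro i
    have e1 : Finset.Ioo i (i + S.n + 1) = insert (i + 1) (Finset.Ioo (i + 1) (i + 1 + S.n)) := by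
      ext k
      simp only [Finset.mem_Ioo, Finset.mem_insert]
      omega
    rw [e1, PolygonDissection.Ioo_succ (by omega), Finset.prod_insert (by simp),
      Finset.prod_insert (by simp), sumAt_add_n]
  have key : ∀ i : ℤ,
      ∏ k ∈ Finset.Ioo i (i + S.n + 1), sumAt (X : D.Subgon → MvPolynomial D.Subgon ℝ) k =
      ∏ k ∈ Finset.Ioo (0 : ℤ) (0 + S.n + 1),
        sumAt (X : D.Subgon → MvPolynomial D.Subgon ℝ) k := by
    intro i
    induction i using Int.induction_on with
    | zero => rfl
    | succ i ih => rw [← step]; exact ih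
    | pred i ih => rw [step, sub_add_cancel]; exact ih
  rw [key i, key j]

namespace Window

variable {k₀ z M N : ℤ} {W : D.Window k₀ z M N}

/-- Different subgons between a bridging arc and its first translate lie over different subgons. -/
lemma proj_subgon_injective {W : D.Window k₀ 1 M N} :
    Function.Injective fun e : W.polygon.Cell => (subgon e).proj := by
  have hpos := W.pos
  have hlt := W.lt
  -- All positive translates of the first arc are nested below the second one.
  have hiter : ∀ s : ℕ, W.φ M ≤ S.deck (s + 1 : ℕ) (W.φ 0) ∧
      S.deck (s + 1 : ℕ) (W.φ N) ≤ W.φ (M + 1) := by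
    intro s
    induction s with
    | zero => exact ⟨W.deck_left.ge, W.deck_right.le⟩
    | succ s ih =>
      have hd : ∀ x, S.deck (s + 1 + 1 : ℕ) x = S.deck (s + 1 : ℕ) (S.deck 1 x) := fun x => by
        rw [show ((s + 1 + 1 : ℕ) : ℤ) = 1 + (s + 1 : ℕ) by push_cast; ring, S.deck_add]
        rfl
      rw [hd, hd, W.deck_left, W.deck_right]
      constructor
      · exact ih.1.trans ((S.deck_lt_deck _).2 (W.mono _ _ le_rfl hpos hlt.le)).le
      · refine le_trans ?_ ih.2
        rw [← not_lt, S.deck_lt_deck, W.lt_iff (by omega) (by omega)]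
        omega
  -- A subgon of the polygon has a vertex strictly below the first arc, so a positive translate has
  -- one strictly below the second arc and is not in the polygon.
  have key : ∀ (y : ℤ) (e f : W.polygon.Cell),
      (∀ v ∈ (subgon e).1, S.deck y v ∈ (subgon f).1) → ¬ 0 < y := by
    intro y e f h hy
    obtain ⟨s, rfl⟩ : ∃ s : ℕ, y = (s + 1 : ℕ) := ⟨(y - 1).toNat, by omega⟩
    obtain ⟨v, hv, hv1, hv2⟩ := exists_mem_between e
    exact not_mem_between f (h v hv) ⟨(hiter s).1.trans_lt ((S.deck_lt_deck _).2 hv1),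
      ((S.deck_lt_deck _).2 hv2).trans_le (hiter s).2⟩
  intro e f hef
  obtain ⟨y, hy⟩ := Quotient.exact hef
  refine subgon_injective (Subtype.ext ?_)
  have hf : subgon f = (subgon e).deck y := Subtype.ext hy
  have h1 := key y e f fun v hv => by rw [hf]; exact CoverSubgon.mem_deck.2 hv
  have h2 := key (-y) f e fun v hv => by
    rw [← (subgon e).deck_neg_deck y, ← hf]
    exact CoverSubgon.mem_deck.2 hv
  obtain rfl : y = 0 := by omega
  rw [hy, S.deck_zero]
  simp

lemma sumAt_X {t : ℤ} (h1 : 0 < t) (h2 : t < M) :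
    sumAt (X : D.Subgon → MvPolynomial D.Subgon ℝ) (k₀ + t) =
      rename (fun e : W.polygon.Cell => (subgon e).proj) (W.polygon.vertexSum t) := by
  simp [sumAt_eq (W := W) _ h1 h2, PolygonDissection.vertexSum]

/-- The product over a period, expressed by the subgons of the polygon. -/
lemma prod_sumAt_eq {n : ℕ} (W : D.Window k₀ z n N) :
    ∏ k ∈ Finset.Ioo (k₀ - 1) (k₀ - 1 + n + 1),
        sumAt (X : D.Subgon → MvPolynomial D.Subgon ℝ) k =
      rename (fun e : W.polygon.Cell => (subgon e).proj)
        (∏ k ∈ Finset.Ico 0 (n : ℤ), W.polygon.vertexSum k +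
          ∏ k ∈ Finset.Ioo 0 ((n : ℤ) + 1), W.polygon.vertexSum k) := by
  have hpos := W.pos
  have e1 : Finset.Ico 0 (n : ℤ) = insert 0 (Finset.Ioo 0 (n : ℤ)) := by
    ext k
    simp only [Finset.mem_Ico, Finset.mem_Ioo, Finset.mem_insert]
    omega
  have e2 : Finset.Ioo (k₀ - 1) (k₀ - 1 + n + 1) =
      insert k₀ ((Finset.Ioo 0 (n : ℤ)).image fun t => k₀ + t) := by
    ext k
    simp only [Finset.mem_Ioo, Finset.mem_insert, Finset.mem_image]
    constructor
    · intro h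
      by_cases hk : k = k₀
      · exact Or.inl hk
      · exact Or.inr ⟨k - k₀, by omega, by omega⟩
    · rintro (rfl | ⟨t, ht, rfl⟩) <;> omega
  rw [e1, PolygonDissection.Ioo_succ hpos, e2, Finset.prod_insert (by simp),
    Finset.prod_insert (by simp), Finset.prod_insert (by simp), ← add_mul, map_mul,
    Finset.prod_image (fun _ _ _ _ h => by simpa using h), map_prod]
  congr 1
  -- The factor at `k₀` is the only one affected by the cut; it becomes the sum of the factors at
  -- `0` and `n`.
  · simp [sumAt_zero (W := W), PolygonDissection.vertexSum]
  · refine Finset.prod_congr rfl fun t ht => ?_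
    rw [Finset.mem_Ioo] at ht
    exact sumAt_X ht.1 ht.2

lemma size_proj_subgon (e : W.polygon.Cell) : (subgon e).proj.size = e.size := size_subgon e

lemma sumAt_chordRatio {t : ℤ} (h1 : 0 < t) (h2 : t < M) :
    sumAt (fun P : D.Subgon => chordRatio P.size) (k₀ + t) = W.polygon.quiddity t := by
  simp only [sumAt_eq (W := W) _ h1 h2, size_proj_subgon, PolygonDissection.quiddity_eq_sum]

end Window

/-- The quiddity row of a frieze pattern that comes from `D`. -/
noncomputable def quiddity (D : S.Dissection) (k : ℤ) : ℝ :=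
  sumAt (fun P : D.Subgon => chordRatio P.size) k

/-- Any finite stretch of the lower boundary fits between two translates of a bridging arc that are
far enough apart, so positivity on polygons suffices. -/
lemma continuant_quiddity_pos (D : S.Dissection) (i : ℤ) {t : ℕ} (ht : 0 < t) :
    0 < continuant D.quiddity i t := by
  obtain ⟨x, y, hxy, -, ⟨p, rfl⟩, hy⟩ := D.exists_bridging
  have hn : (1 : ℤ) ≤ S.n := by exact_mod_cast S.one_le_n
  -- As each period has length at least 1, the window from `p - d * n` to `p + (d + 1) * n` contains
  -- `i` and `i + t`.
  set d : ℤ := |i - p| + t with hd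
  have h1 := D.deck_mem (-d) _ _ hxy
  have h2 := le_abs_self (i - p)
  have h3 := neg_abs_le (i - p)
  have hd0 : 0 < d := by positivity
  have hy' : ¬ ∃ l, S.deck (-d) y = .outer l := by
    rintro ⟨l, hl⟩
    refine hy ⟨l + d * S.n, ?_⟩
    rw [← S.deck_deck_neg d y, hl, S.deck_outer]
  obtain ⟨N, ⟨W⟩⟩ := exists_window h1 hy' (show 0 < 2 * d + 1 by omega)
  refine PolygonDissection.continuant_pos_of_quiddity (G := W.polygon) W.lt.le
    (fun k h1 h2 => Window.sumAt_chordRatio h1 h2) ht ?_ ?_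
  · nlinarith
  · nlinarith

end Surface.Dissection

open Surface.Dissection in
theorem mainTheorem5 (S : Surface) (D : S.Dissection) (m : ℤ → ℤ → ℝ)
    (hm : IsInfiniteFrieze m) (hD : D.Realizes m) (i : ℤ) :
    principalGrowthCoefficient S.n m =
      ∑ w : D.Matching i (i + S.n + 1), Surface.Dissection.annulusWeight w := by
  obtain ⟨x, y, hxy, -, ⟨k₀, rfl⟩, hy⟩ := D.exists_bridging
  -- A width of exactly one period is needed: in a wider window, different cells could lie over the
  -- same subgon of the surface.
  obtain ⟨N, ⟨W⟩⟩ := exists_window hxy hy one_pos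
  rw [one_mul] at W
  have hn := S.one_le_n
  have hfrieze := frieze_eq_continuant hm (a := D.quiddity) (fun i => hD i)
    (fun i t ht => (D.continuant_quiddity_pos i ht).ne')
  have hs : principalGrowthCoefficient S.n m =
      continuant D.quiddity 0 (S.n + 1) - continuant D.quiddity (0 + 1) (S.n - 1) := by
    rw [principalGrowthCoefficient, ← hfrieze, ← hfrieze]
    congr 2
    · push_cast; ring
    · push_cast [hn]; ring
  -- Periodicity moves the growth coefficient to the cut at `k₀`; the product over a period is moved
  -- there by `prod_sumAt_shift`.
  rw [hs, growth_shift hn (show ∀ k, D.quiddity (k + S.n) = D.quiddity k from sumAt_add_n _) 0 k₀,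
    ← PolygonDissection.weightFunctional_add_eq_growth (G := W.polygon) hn W.lt]
  · rw [sum_annulusWeight, prod_sumAt_shift i (k₀ - 1), W.prod_sumAt_eq,
      weightFunctional_rename Window.proj_subgon_injective, map_add]
    simp only [Window.size_proj_subgon]
  · intro k h1 h2
    exact Window.sumAt_chordRatio h1 h2
  · have h := Window.sumAt_zero (W := W) (fun P : D.Subgon => chordRatio P.size)
    rw [show D.quiddity (k₀ + S.n) = D.quiddity k₀ from sumAt_add_n _ _]
    simp only [Window.size_proj_subgon, ← PolygonDissection.quiddity_eq_sum] at h
    exact h
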